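/- Let $\mathbb{D}=\{z\in\mathbb{C}:|z|<1\}$, let $\mathbb{T}=\{z\in\mathbb{C}:|z|=1\}$, let $E\subset\mathbb{T}$ be a finite nonempty set, and write $\operatorname{dist}(z,E)=\min_{\zeta\in E}|z-\zeta|$ and $x_+=\max\{x,0\}$. Let $p,q\ge 0$ be real numbers. Then for every $\varepsilon>0$ there is a constant $C(\varepsilon,p,q,E)>0$, depending only on $\varepsilon,p,q,E$, such that for every real number $D_1$ and every analytic function $f$ on $\mathbb{D}$ with $|f(0)|=1$ and $$|f(z)|\le \exp\Bigl(\frac{D_1}{(1-|z|)^p\,\operatorname{dist}(z,E)^q}\Bigr)\qquad (z\in\mathbb{D}),$$ one has $$\sum_{z\in Z_f}(1-|z|)^{p+1+\varepsilon}\,\operatorname{dist}(z,E)^{(q-1+\varepsilon)_+}\le C(\varepsilon,p,q,E)\,D_1,$$ where $Z_f$ denotes the zeros of $f$ in $\mathbb{D}$, each counted with its multiplicity; in particular the series converges. -/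

import Mathlib

/-- The zero set of `f` in the open unit disk (as a set; multiplicities are recorded separately
by `analyticOrderNatAt f`). -/
def diskZeros (f : ℂ → ℂ) : Set ℂ :=
  {z : ℂ | z ∈ Metric.ball (0 : ℂ) 1 ∧ f z = 0}

/-- The contribution of a point `z` to the Blaschke-type sum: the multiplicity of `z` as a zero
of `f`, times `(1 - |z|) ^ s * dist(z, E) ^ r`. -/
noncomputable def blaschkeTerm (f : ℂ → ℂ) (E : Set ℂ) (s r : ℝ) (z : ℂ) : ℝ :=
  (analyticOrderNatAt f z : ℝ) * ((1 - ‖z‖) ^ s * Metric.infDist z E ^ r)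

/-! The proof tests `log |f|` against the Laplacian of a weight that imitates the summand. Put `s =
p + 1 + ε`, `a = (q - 1 + ε)_+` and `G = ∏ (1 - z/ζ)^(a/2)` over `ζ ∈ E`, so that `|G|²` is
comparable to `dist(z, E)^a`. The weight `φ = (1 - |z|²)^s |G|²` is cut off for `1 - |z|² ≤ δ`, and
Green's formula (`IsTestFunction.exists_integral_log_norm_mul`) turns `∫ log |f| Δφ` into a positive
constant times the sum of `φ` over the zeros with multiplicity.

The integral has to be bounded above, but `log |f|` is bounded on one side only. Near the circle
this suffices, because there `Δφ ≥ 0` (`laplacian_weightTest_nonneg`): with `V = (1 - |z|)^(-p)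
dist(z, E)^(-q)`, `log |f|` may be replaced by `D₁ V`. On the remaining disc `|z| < ρ` the Laplacian
is bounded, and Jensen's formula with `|f(0)| = 1` makes the area mean of `log |f|` nonnegative,
which bounds `∫ |log |f||` by `2 D₁ ∫ V`.

It remains that `V |Δφ|` is integrable uniformly in `δ`. Since `|Δφ|` is at most a constant times
`|G|² (1 - |z|²)^(s-2)`, the product is at most a constant times `(1 - |z|)^(ε-1) dist(z, E)^(a-q)`,
where `a - q ≥ ε - 1`; both singularities are integrable (`integrableOn_majorant_mul_weight`).
Finally `δ → 0` (`exists_weighted_blaschke_bound`). -/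

open MeasureTheory Filter Topology

/-! ### The radial profile: a power with a `C²` cut-off -/

/-- `v ^ s` cut off smoothly (to class `C²`) below `v = δ`. -/
noncomputable def cutPow (s δ v : ℝ) : ℝ := v ^ (s - 3) * max (v - δ) 0 ^ 3

/-- The first derivative of `cutPow`. -/
noncomputable def cutPow₁ (s δ v : ℝ) : ℝ :=
  3 * v ^ (s - 3) * max (v - δ) 0 ^ 2 + (s - 3) * v ^ (s - 4) * max (v - δ) 0 ^ 3

/-- The second derivative of `cutPow`. -/
noncomputable def cutPow₂ (s δ v : ℝ) : ℝ :=
  6 * v ^ (s - 3) * max (v - δ) 0 + 6 * (s - 3) * v ^ (s - 4) * max (v - δ) 0 ^ 2 +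
    (s - 3) * (s - 4) * v ^ (s - 5) * max (v - δ) 0 ^ 3

/-- Squaring already removes the corner at `0`; this is why the cube in `cutPow` yields class `C²`.
-/
lemma hasDerivAt_max_zero_pow (n : ℕ) (y : ℝ) :
    HasDerivAt (fun y : ℝ => max y 0 ^ (n + 2)) ((n + 2) * max y 0 ^ (n + 1)) y := by
  rcases lt_trichotomy y 0 with hy | hy | hy
  · have h : (fun y : ℝ => max y 0 ^ (n + 2)) =ᶠ[nhds y] fun _ => 0 := by
      filter_upwards [gt_mem_nhds hy] with t ht
      simp [max_eq_right ht.le]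
    rw [max_eq_right hy.le]
    simpa using (hasDerivAt_const y (0 : ℝ)).congr_of_eventuallyEq h
  · subst hy
    have : HasDerivAt (fun y : ℝ => max y 0 ^ (n + 2)) 0 0 := by
      rw [hasDerivAt_iff_isLittleO]
      simp only [max_self, sub_zero, smul_zero, ne_eq, Nat.add_eq_zero_iff, OfNat.ofNat_ne_zero,
        and_false, not_false_eq_true, zero_pow]
      have h1 : (fun y : ℝ => max y 0 ^ (n + 2)) =O[nhds 0] fun y : ℝ => y ^ (n + 2) := by
        refine Asymptotics.isBigO_of_le _ fun t => ?_
        rw [norm_pow, norm_pow]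
        gcongr
        rw [Real.norm_eq_abs, Real.norm_eq_abs, abs_of_nonneg (le_max_right _ _)]
        exact max_le (le_abs_self t) (abs_nonneg t)
      exact h1.trans_isLittleO (Asymptotics.isLittleO_pow_id (by omega))
    simpa using this
  · have h : (fun y : ℝ => max y 0 ^ (n + 2)) =ᶠ[nhds y] fun y => y ^ (n + 2) := by
      filter_upwards [lt_mem_nhds hy] with t ht
      simp [max_eq_left ht.le]
    rw [max_eq_left hy.le]
    simpa using (hasDerivAt_pow (n + 2) y).congr_of_eventuallyEq h

lemma hasDerivAt_cutPow {s δ v : ℝ} (hv : 0 < v) :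
    HasDerivAt (cutPow s δ) (cutPow₁ s δ v) v := by
  have h1 := (hasDerivAt_max_zero_pow 1 (v - δ)).comp v ((hasDerivAt_id v).sub_const δ)
  have h2 := Real.hasDerivAt_rpow_const (p := s - 3) (Or.inl hv.ne')
  refine (h2.mul h1).congr_deriv ?_
  rw [show s - 3 - 1 = s - 4 by ring]
  simp only [cutPow₁, Function.comp, id]
  push_cast
  ring

lemma hasDerivAt_cutPow₁ {s δ v : ℝ} (hv : 0 < v) :
    HasDerivAt (cutPow₁ s δ) (cutPow₂ s δ v) v := by
  have h0 := (hasDerivAt_max_zero_pow 0 (v - δ)).comp v ((hasDerivAt_id v).sub_const δ)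
  have h1 := (hasDerivAt_max_zero_pow 1 (v - δ)).comp v ((hasDerivAt_id v).sub_const δ)
  have h2 := Real.hasDerivAt_rpow_const (p := s - 3) (Or.inl hv.ne')
  have h3 := Real.hasDerivAt_rpow_const (p := s - 4) (Or.inl hv.ne')
  refine (((h2.const_mul 3).mul h0).add ((h3.const_mul (s - 3)).mul h1)).congr_deriv ?_
  rw [show s - 3 - 1 = s - 4 by ring, show s - 4 - 1 = s - 5 by ring]
  simp only [cutPow₂, Function.comp, id]
  push_cast
  ring

section bounds

variable {s δ v : ℝ}

lemma max_sub_zero_le (hδ : 0 < δ) (hv : 0 < v) : max (v - δ) 0 ≤ v :=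
  max_le (by linarith) hv.le

lemma cutPow₁_eq (hv : 0 < v) : cutPow₁ s δ v =
    v ^ (s - 4) * max (v - δ) 0 ^ 2 * (3 * v + (s - 3) * max (v - δ) 0) := by
  rw [cutPow₁, show s - 3 = (s - 4) + 1 by ring, Real.rpow_add_one hv.ne']
  ring

lemma cutPow₂_eq (hv : 0 < v) : cutPow₂ s δ v =
    v ^ (s - 5) * max (v - δ) 0 * (6 * v ^ 2 + 6 * (s - 3) * (v * max (v - δ) 0) +
      (s - 3) * (s - 4) * max (v - δ) 0 ^ 2) := by
  rw [cutPow₂, show s - 4 = (s - 5) + 1 by ring, Real.rpow_add_one hv.ne',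
    show s - 3 = (s - 5) + 1 + 1 by ring, Real.rpow_add_one hv.ne', Real.rpow_add_one hv.ne']
  ring

lemma cutPow_nonneg (hv : 0 ≤ v) : 0 ≤ cutPow s δ v := by
  unfold cutPow; positivity

lemma cutPow_le (hδ : 0 < δ) (hv : 0 < v) : cutPow s δ v ≤ v ^ s := by
  have h : v ^ s = v ^ (s - 3) * v ^ 3 := by
    rw [← Real.rpow_natCast v 3, ← Real.rpow_add hv]; norm_num
  rw [h, cutPow]
  gcongr
  exact max_sub_zero_le hδ hv

lemma cutPow₁_nonneg (hs : 1 < s) (hδ : 0 < δ) (hv : 0 < v) : 0 ≤ cutPow₁ s δ v := by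
  rw [cutPow₁_eq hv]
  have h1 := max_sub_zero_le hδ hv
  have h2 : 0 ≤ max (v - δ) 0 := le_max_right _ _
  have : 0 ≤ 3 * v + (s - 3) * max (v - δ) 0 := by nlinarith
  positivity

/-- As for `cutPow_le` and `abs_cutPow₂_le`, the point is that the constant is free of `δ`: all
three survive the limit `δ → 0`. -/
lemma cutPow₁_le (hs : 1 < s) (hδ : 0 < δ) (hv : 0 < v) :
    cutPow₁ s δ v ≤ (s + 3) * v ^ (s - 1) := by
  have h : v ^ (s - 1) = v ^ (s - 4) * v ^ 3 := by
    rw [← Real.rpow_natCast v 3, ← Real.rpow_add hv]; congr 1; push_cast; ring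
  rw [cutPow₁_eq hv, h]
  have h1 := max_sub_zero_le hδ hv
  have h2 : 0 ≤ max (v - δ) 0 := le_max_right _ _
  have h3 : 3 * v + (s - 3) * max (v - δ) 0 ≤ (s + 3) * v := by nlinarith
  have h4 : 0 ≤ 3 * v + (s - 3) * max (v - δ) 0 := by nlinarith
  calc _ ≤ v ^ (s - 4) * v ^ 2 * ((s + 3) * v) := by gcongr
    _ = _ := by ring

lemma abs_cutPow₂_le (hs : 1 < s) (hδ : 0 < δ) (hv : 0 < v) :
    |cutPow₂ s δ v| ≤ (6 + 6 * (s + 3) + (s + 3) * (s + 4)) * v ^ (s - 2) := by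
  have h : v ^ (s - 2) = v ^ (s - 5) * v ^ 3 := by
    rw [← Real.rpow_natCast v 3, ← Real.rpow_add hv]; congr 1; push_cast; ring
  rw [cutPow₂_eq hv, h]
  have h1 := max_sub_zero_le hδ hv
  have h2 : 0 ≤ max (v - δ) 0 := le_max_right _ _
  set m := max (v - δ) 0
  have h3 : |6 * v ^ 2 + 6 * (s - 3) * (v * m) + (s - 3) * (s - 4) * m ^ 2| ≤
      (6 + 6 * (s + 3) + (s + 3) * (s + 4)) * v ^ 2 := by
    have e1 : |s - 3| ≤ s + 3 := abs_le.2 ⟨by linarith, by linarith⟩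
    have e2 : |s - 4| ≤ s + 4 := abs_le.2 ⟨by linarith, by linarith⟩
    calc _ ≤ |6 * v ^ 2| + |6 * (s - 3) * (v * m)| + |(s - 3) * (s - 4) * m ^ 2| :=
          abs_add_three _ _ _
      _ = 6 * v ^ 2 + 6 * |s - 3| * (v * m) + |s - 3| * |s - 4| * m ^ 2 := by
          simp only [abs_mul, abs_pow, abs_of_pos hv, abs_of_nonneg h2]; norm_num
      _ ≤ 6 * v ^ 2 + 6 * (s + 3) * (v * v) + (s + 3) * (s + 4) * v ^ 2 := by gcongr
      _ = _ := by ring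
  rw [abs_mul, abs_mul, abs_of_nonneg h2, abs_of_nonneg (by positivity : 0 ≤ v ^ (s - 5))]
  calc _ ≤ v ^ (s - 5) * v * ((6 + 6 * (s + 3) + (s + 3) * (s + 4)) * v ^ 2) := by gcongr
    _ = _ := by ring

/-- The pure power `v ^ s` gives equality. With `m = max (v - δ) 0 ≤ v`, the cut-off adds `v^(s-4) m
· 3 (v - m)(2v + (s - 3) m)`, which is nonnegative for `s > 1`. The sign of the Laplacian near the
circle rests on this. -/
lemma sub_one_mul_cutPow₁_le (hs : 1 < s) (hδ : 0 < δ) (hv : 0 < v) :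
    (s - 1) * cutPow₁ s δ v ≤ v * cutPow₂ s δ v := by
  rw [cutPow₁_eq hv, cutPow₂_eq hv, show s - 4 = (s - 5) + 1 by ring, Real.rpow_add_one hv.ne']
  have h1 := max_sub_zero_le hδ hv
  have h2 : 0 ≤ max (v - δ) 0 := le_max_right _ _
  set m := max (v - δ) 0
  have h3 : 0 ≤ 3 * (v - m) * (2 * v - 3 * m + s * m) := by
    have : 0 ≤ 2 * v - 3 * m + s * m := by nlinarith
    have : 0 ≤ v - m := by linarith
    positivity
  have h4 : 0 ≤ v ^ (s - 5) * v * m := by positivity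
  nlinarith [mul_nonneg h4 h3]

end bounds

/-! ### Test functions and integration by parts along lines -/

/-- `φ` is a function of class `C²` on the plane that vanishes off `K`; `d e` and `dd e` are its
first and second derivatives in the direction `e`. -/
structure IsTestFunction (K : Set ℂ) (φ : ℂ → ℝ) (d dd : ℂ → ℂ → ℝ) : Prop where
  eq_zero : ∀ z ∉ K, φ z = 0
  d_eq_zero : ∀ e, ∀ z ∉ K, d e z = 0
  dd_eq_zero : ∀ e, ∀ z ∉ K, dd e z = 0
  hasLineDerivAt : ∀ e z, HasLineDerivAt ℝ φ (d e z) z e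
  hasLineDerivAt_d : ∀ e z, HasLineDerivAt ℝ (d e) (dd e z) z e
  cont : Continuous φ
  cont_d : ∀ e, Continuous (d e)
  cont_dd : ∀ e, Continuous (dd e)

lemma integrable_of_continuousOn_of_eq_zero {K : Set ℂ} (hK : IsCompact K) {g : ℂ → ℝ}
    (hg : ContinuousOn g K) (h0 : ∀ z ∉ K, g z = 0) : Integrable g :=
  (integrableOn_iff_integrable_of_support_subset fun z hz => by
    by_contra h; exact hz (h0 z h)).1 (hg.integrableOn_compact hK)

lemma tsupport_subset_of_eq_zero {K : Set ℂ} (hK : IsCompact K) {g : ℂ → ℝ}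
    (h0 : ∀ z ∉ K, g z = 0) : tsupport g ⊆ K :=
  closure_minimal (fun z hz => by by_contra h; exact hz (h0 z h)) hK.isClosed

namespace IsTestFunction

variable {K : Set ℂ} {φ : ℂ → ℝ} {d dd : ℂ → ℂ → ℝ}

/-- Integrating by parts twice against a test function. -/
lemma integral_mul_dd (h : IsTestFunction K φ d dd) (hK : IsCompact K) {u u' u'' : ℂ → ℝ} {e : ℂ}
    (hu : ∀ z ∈ K, HasLineDerivAt ℝ u (u' z) z e)
    (hu' : ∀ z ∈ K, HasLineDerivAt ℝ u' (u'' z) z e)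
    (cu : ContinuousOn u K) (cu' : ContinuousOn u' K) (cu'' : ContinuousOn u'' K) :
    ∫ z, u z * dd e z = ∫ z, u'' z * φ z := by
  have key : ∀ {a b : ℂ → ℝ}, ContinuousOn a K → Continuous b → (∀ z ∉ K, b z = 0) →
      Integrable fun z => ContinuousLinearMap.mul ℝ ℝ (a z) (b z) := fun ha hb h0 =>
    integrable_of_continuousOn_of_eq_zero hK (ha.mul hb.continuousOn)
      fun z hz => by simp [h0 z hz]
  have e1 := integral_bilinear_hasLineDerivAt_right_eq_neg_left_of_integrable (μ := volume)
    (B := ContinuousLinearMap.mul ℝ ℝ) (f := u) (f' := u') (g := d e) (g' := dd e) (v := e)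
    (key cu' (h.cont_d e) (h.d_eq_zero e)) (key cu (h.cont_dd e) (h.dd_eq_zero e))
    (key cu (h.cont_d e) (h.d_eq_zero e))
    (fun z hz => hu z (tsupport_subset_of_eq_zero hK (h.d_eq_zero e) hz))
    (fun z _ => h.hasLineDerivAt_d e z)
  have e2 := integral_bilinear_hasLineDerivAt_right_eq_neg_left_of_integrable (μ := volume)
    (B := ContinuousLinearMap.mul ℝ ℝ) (f := u') (f' := u'') (g := φ) (g' := d e) (v := e)
    (key cu'' h.cont h.eq_zero) (key cu' (h.cont_d e) (h.d_eq_zero e))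
    (key cu' h.cont h.eq_zero)
    (fun z hz => hu' z (tsupport_subset_of_eq_zero hK h.eq_zero hz))
    (fun z _ => h.hasLineDerivAt e z)
  simp only [ContinuousLinearMap.mul_apply'] at e1 e2
  rw [e1, e2, neg_neg]

lemma integrable_mul (h : IsTestFunction K φ d dd) (hK : IsCompact K) {u : ℂ → ℝ}
    (hu : IntegrableOn u K) : Integrable fun z => u z * φ z := by
  refine (integrableOn_iff_integrable_of_support_subset (s := K) fun z hz => ?_).1
    (hu.mul_continuousOn h.cont.continuousOn hK)
  by_contra hzK
  exact hz (by simp [h.eq_zero z hzK])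

lemma integrable_mul_dd (h : IsTestFunction K φ d dd) (hK : IsCompact K) {u : ℂ → ℝ}
    (hu : IntegrableOn u K) (e : ℂ) : Integrable fun z => u z * dd e z := by
  refine (integrableOn_iff_integrable_of_support_subset (s := K) fun z hz => ?_).1
    (hu.mul_continuousOn (h.cont_dd e).continuousOn hK)
  by_contra hzK
  exact hz (by simp [h.dd_eq_zero e z hzK])

end IsTestFunction

/-! ### The Laplacian of the regularised logarithm -/

/-- The derivative along a real line of a complex-differentiable function. -/
lemma HasDerivAt.comp_line {g : ℂ → ℂ} {g' z : ℂ} (hg : HasDerivAt g g' z) (e : ℂ) :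
    HasDerivAt (fun t : ℝ => g (z + t • e)) (e * g') 0 := by
  have h1 : HasDerivAt (fun t : ℝ => z + t • e) e 0 := by
    simpa using ((hasDerivAt_id (0 : ℝ)).smul_const e).const_add z
  have h2 : HasDerivAt g g' (z + (0 : ℝ) • e) := by simpa using hg
  simpa [mul_comm, Function.comp_def] using HasDerivAt.scomp (0 : ℝ) h2 h1

lemma hasLineDerivAt_log_norm_sq_add {h h' : ℂ → ℂ} {δ : ℝ} {z e : ℂ}
    (hh : HasDerivAt h (h' z) z) (hpos : ‖h z‖ ^ 2 + δ ≠ 0) :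
    HasLineDerivAt ℝ (fun z => Real.log (‖h z‖ ^ 2 + δ) / 2)
      (inner ℝ (h z) (e * h' z) / (‖h z‖ ^ 2 + δ)) z e := by
  have h1 := ((hh.comp_line e).norm_sq.add_const δ).log (by simpa using hpos)
  refine (h1.div_const 2).congr_deriv ?_
  simp only [zero_smul, add_zero]
  rw [mul_div_assoc, mul_div_cancel_left₀ _ two_ne_zero]

lemma hasLineDerivAt_log_norm_sq_add_deriv {h h' h'' : ℂ → ℂ} {δ : ℝ} {z e : ℂ}
    (hh : HasDerivAt h (h' z) z) (hh' : HasDerivAt h' (h'' z) z) (hpos : ‖h z‖ ^ 2 + δ ≠ 0) :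
    HasLineDerivAt ℝ (fun z => inner ℝ (h z) (e * h' z) / (‖h z‖ ^ 2 + δ))
      ((inner ℝ (h z) (e * (e * h'' z)) + ‖e * h' z‖ ^ 2) / (‖h z‖ ^ 2 + δ) -
        2 * inner ℝ (h z) (e * h' z) ^ 2 / (‖h z‖ ^ 2 + δ) ^ 2) z e := by
  have h1 := ((hh.comp_line e).norm_sq.add_const δ)
  have h2 := ((hh.comp_line e).inner ℝ ((hh'.comp_line e).const_mul e)).div h1
    (by simpa using hpos)
  refine h2.congr_deriv ?_
  simp only [zero_smul, add_zero, real_inner_self_eq_norm_sq]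
  field_simp

/-- Here `a`, `b`, `c` stand for `h`, `h'`, `h''`. By the Cauchy–Riemann equations the `h''` terms
for the directions `1` and `I` cancel, as `I² = -1`. -/
lemma laplacian_log_norm_sq_add (a b c : ℂ) {δ : ℝ} (hpos : ‖a‖ ^ 2 + δ ≠ 0) :
    ((inner ℝ a (1 * (1 * c)) + ‖1 * b‖ ^ 2) / (‖a‖ ^ 2 + δ) -
        2 * inner ℝ a (1 * b) ^ 2 / (‖a‖ ^ 2 + δ) ^ 2) +
      ((inner ℝ a (Complex.I * (Complex.I * c)) + ‖Complex.I * b‖ ^ 2) / (‖a‖ ^ 2 + δ) -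
        2 * inner ℝ a (Complex.I * b) ^ 2 / (‖a‖ ^ 2 + δ) ^ 2) =
      2 * δ * ‖b‖ ^ 2 / (‖a‖ ^ 2 + δ) ^ 2 := by
  field_simp
  simp only [Complex.inner, ← Complex.normSq_eq_norm_sq, Complex.normSq_apply]
  simp
  ring

/-- Used twice: `δ = 0` gives harmonicity off the zeros, and `δ → 0` with `h = z - c` produces a
point mass at `c`. -/
lemma IsTestFunction.integral_log_norm_sq_add_mul {K : Set ℂ} {φ : ℂ → ℝ} {d dd : ℂ → ℂ → ℝ}
    (ht : IsTestFunction K φ d dd) (hK : IsCompact K) {h : ℂ → ℂ} (hh : AnalyticOnNhd ℂ h K)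
    {δ : ℝ} (hpos : ∀ z ∈ K, ‖h z‖ ^ 2 + δ ≠ 0) :
    ∫ z, Real.log (‖h z‖ ^ 2 + δ) / 2 * (dd 1 z + dd Complex.I z) =
      ∫ z, 2 * δ * ‖deriv h z‖ ^ 2 / (‖h z‖ ^ 2 + δ) ^ 2 * φ z := by
  have hd := hh.deriv
  have hdd := hd.deriv
  have c0 := hh.continuousOn
  have c1 := hd.continuousOn
  have c2 := hdd.continuousOn
  have cB : ContinuousOn (fun z => ‖h z‖ ^ 2 + δ) K := by fun_prop
  have cu : ContinuousOn (fun z => Real.log (‖h z‖ ^ 2 + δ) / 2) K :=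
    (cB.log hpos).div_const 2
  have cu' (e : ℂ) : ContinuousOn (fun z => inner ℝ (h z) (e * deriv h z) / (‖h z‖ ^ 2 + δ)) K :=
    ContinuousOn.div (ContinuousOn.inner c0 (by fun_prop)) cB hpos
  have cu'' (e : ℂ) : ContinuousOn (fun z =>
      (inner ℝ (h z) (e * (e * deriv (deriv h) z)) + ‖e * deriv h z‖ ^ 2) / (‖h z‖ ^ 2 + δ) -
        2 * inner ℝ (h z) (e * deriv h z) ^ 2 / (‖h z‖ ^ 2 + δ) ^ 2) K := by
    refine ContinuousOn.sub (ContinuousOn.div (ContinuousOn.add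
      (ContinuousOn.inner c0 (by fun_prop)) (by fun_prop)) cB hpos)
      (ContinuousOn.div (ContinuousOn.mul continuousOn_const
        ((ContinuousOn.inner c0 (by fun_prop)).pow 2)) (cB.pow 2) fun z hz => ?_)
    exact pow_ne_zero 2 (hpos z hz)
  have key (e : ℂ) := ht.integral_mul_dd hK (e := e)
    (fun z hz => hasLineDerivAt_log_norm_sq_add (h' := deriv h)
      (hh z hz).differentiableAt.hasDerivAt (hpos z hz))
    (fun z hz => hasLineDerivAt_log_norm_sq_add_deriv
      (hh z hz).differentiableAt.hasDerivAt (hd z hz).differentiableAt.hasDerivAt (hpos z hz))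
    cu (cu' e) (cu'' e)
  have iu := cu.integrableOn_compact hK (μ := volume)
  simp only [mul_add]
  rw [integral_add (ht.integrable_mul_dd hK iu 1) (ht.integrable_mul_dd hK iu Complex.I),
    key, key, ← integral_add (ht.integrable_mul hK ((cu'' 1).integrableOn_compact hK))
      (ht.integrable_mul hK ((cu'' Complex.I).integrableOn_compact hK))]
  refine integral_congr_ae (Eventually.of_forall fun z => ?_)
  by_cases hz : z ∈ K
  · dsimp only
    rw [← add_mul, laplacian_log_norm_sq_add _ _ _ (hpos z hz)]
  · simp [ht.eq_zero z hz]

/-- `log |h|` is harmonic where `h` has no zeros. -/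
lemma IsTestFunction.integral_log_norm_mul_eq_zero {K : Set ℂ} {φ : ℂ → ℝ} {d dd : ℂ → ℂ → ℝ}
    (ht : IsTestFunction K φ d dd) (hK : IsCompact K) {h : ℂ → ℂ} (hh : AnalyticOnNhd ℂ h K)
    (h0 : ∀ z ∈ K, h z ≠ 0) :
    ∫ z, Real.log ‖h z‖ * (dd 1 z + dd Complex.I z) = 0 := by
  have := ht.integral_log_norm_sq_add_mul hK hh (δ := 0) (fun z hz => by simpa using h0 z hz)
  simpa [Real.log_pow] using this

/-! ### The Laplacian of `log |z - c|` as a point mass -/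

/-- The mass of the Laplacian of `log |z|` at the origin. -/
noncomputable def logLaplacianMass : ℝ := ∫ w : ℂ, 2 / (‖w‖ ^ 2 + 1) ^ 2

lemma integrable_two_div_norm_sq_add_one_sq :
    Integrable fun w : ℂ => 2 / (‖w‖ ^ 2 + 1) ^ 2 := by
  have := (integrable_rpow_neg_one_add_norm_sq (E := ℂ) (μ := volume) (r := 4)
    (by simp; norm_num)).const_mul 2
  refine this.congr (Eventually.of_forall fun w => ?_)
  have h : (0 : ℝ) ≤ 1 + ‖w‖ ^ 2 := by positivity
  simp only
  rw [show (-4 / 2 : ℝ) = -(2 : ℕ) by norm_num, Real.rpow_neg h, Real.rpow_natCast, add_comm,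
    div_eq_mul_inv]

/-- The value is `2π`, but only positivity is needed, in order to divide by it. -/
lemma logLaplacianMass_pos : 0 < logLaplacianMass := by
  refine (integral_pos_iff_support_of_nonneg (fun w => by positivity)
    integrable_two_div_norm_sq_add_one_sq).2 ?_
  have : Function.support (fun w : ℂ => 2 / (‖w‖ ^ 2 + 1) ^ 2) = Set.univ := by
    ext w
    simp only [Function.mem_support, Set.mem_univ, iff_true]
    positivity
  simp [this]

/-- In polar coordinates about `c` the Jacobian turns the singularity into `y * log y`, which is
continuous at `0`. -/
lemma integrableOn_log_norm_sub (c : ℂ) {K : Set ℂ} (hK : IsCompact K) :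
    IntegrableOn (fun z => Real.log ‖z - c‖) K := by
  obtain ⟨R, hR⟩ := hK.isBounded.subset_closedBall c
  refine IntegrableOn.mono_set ?_ hR
  have h1 : Integrable fun x : ℂ => (Set.Iic R).indicator Real.log ‖x‖ := by
    rw [integrable_fun_norm_addHaar volume (f := (Set.Iic R).indicator Real.log)]
    have : (fun y : ℝ => y ^ (Module.finrank ℝ ℂ - 1) • (Set.Iic R).indicator Real.log y) =
        (Set.Iic R).indicator fun y => y * Real.log y := by
      ext y
      by_cases hy : y ∈ Set.Iic R <;> simp [hy]
    rw [this, integrableOn_indicator_iff measurableSet_Iic, Set.inter_comm, Set.Ioi_inter_Iic]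
    exact (Real.continuous_mul_log.continuousOn.integrableOn_compact
      (isCompact_Icc (a := 0) (b := R))).mono_set Set.Ioc_subset_Icc_self
  have h2 := (h1.comp_sub_right c).integrableOn (s := Metric.closedBall c R)
  refine h2.congr_fun (fun z hz => ?_) measurableSet_closedBall
  simp [Set.indicator, (mem_closedBall_iff_norm.1 hz)]

/-- An approximate identity: with `t = 1 / (n + 1)`, the substitution `z = t w + c` makes the kernel
independent of `n` and moves `n` into the argument of `φ`. -/
lemma integral_smooth_log_laplacian {φ : ℂ → ℝ} (hφ : Continuous φ) {M : ℝ}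
    (hM : ∀ z, |φ z| ≤ M) (c : ℂ) :
    Tendsto (fun n : ℕ => ∫ z, 2 * ((1 / (n + 1 : ℝ)) ^ 2) /
      (‖z - c‖ ^ 2 + (1 / (n + 1 : ℝ)) ^ 2) ^ 2 * φ z) atTop (𝓝 (logLaplacianMass * φ c)) := by
  have e1 (n : ℕ) : ∫ z, 2 * ((1 / (n + 1 : ℝ)) ^ 2) /
      (‖z - c‖ ^ 2 + (1 / (n + 1 : ℝ)) ^ 2) ^ 2 * φ z =
      ∫ w : ℂ, 2 / (‖w‖ ^ 2 + 1) ^ 2 * φ ((1 / (n + 1 : ℝ)) • w + c) := by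
    have ht : (0 : ℝ) < 1 / (n + 1 : ℝ) := by positivity
    set t := 1 / (n + 1 : ℝ)
    rw [← integral_add_right_eq_self _ c]
    simp only [add_sub_cancel_right]
    have := Measure.integral_comp_smul (volume : Measure ℂ)
      (fun z => 2 * t ^ 2 / (‖z‖ ^ 2 + t ^ 2) ^ 2 * φ (z + c)) t
    rw [Complex.finrank_real_complex, abs_of_pos (by positivity), smul_eq_mul] at this
    rw [← mul_right_inj' (inv_ne_zero (pow_ne_zero 2 ht.ne')), ← this, ← integral_const_mul]
    refine integral_congr_ae (Eventually.of_forall fun w => ?_)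
    simp only [norm_smul, Real.norm_eq_abs, abs_of_pos ht]
    field_simp
  simp only [e1]
  rw [logLaplacianMass, ← integral_mul_const]
  refine tendsto_integral_of_dominated_convergence (fun w => 2 / (‖w‖ ^ 2 + 1) ^ 2 * M)
    (fun n => ?_) (integrable_two_div_norm_sq_add_one_sq.mul_const M)
    (fun n => Eventually.of_forall fun w => ?_) (Eventually.of_forall fun w => ?_)
  · refine Continuous.aestronglyMeasurable (Continuous.mul (Continuous.div continuous_const
      (by fun_prop) fun w => ?_) (by fun_prop))
    positivity
  · rw [norm_mul, Real.norm_eq_abs, Real.norm_eq_abs, abs_of_pos (by positivity)]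
    gcongr
    exact hM _
  · refine Tendsto.const_mul _ ((hφ.tendsto c).comp ?_)
    have := ((tendsto_one_div_add_atTop_nhds_zero_nat (𝕜 := ℝ)).smul_const w).add_const c
    simpa using this

lemma IsTestFunction.integral_log_norm_sub_mul {K : Set ℂ} {φ : ℂ → ℝ} {d dd : ℂ → ℂ → ℝ}
    (ht : IsTestFunction K φ d dd) (hK : IsCompact K) (c : ℂ) :
    ∫ z, Real.log ‖z - c‖ * (dd 1 z + dd Complex.I z) = logLaplacianMass * φ c := by
  obtain ⟨M, hM⟩ : ∃ M, ∀ z, |φ z| ≤ M := by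
    obtain ⟨M, hM⟩ := hK.exists_bound_of_continuousOn ht.cont.continuousOn
    refine ⟨max M 0, fun z => ?_⟩
    by_cases hz : z ∈ K
    · exact (hM z hz).trans (le_max_left _ _)
    · simp [ht.eq_zero z hz]
  have hpos (n : ℕ) : (0 : ℝ) < (1 / (n + 1 : ℝ)) ^ 2 := by positivity
  have e1 (n : ℕ) : ∫ z, Real.log (‖z - c‖ ^ 2 + (1 / (n + 1 : ℝ)) ^ 2) / 2 *
      (dd 1 z + dd Complex.I z) = ∫ z, 2 * ((1 / (n + 1 : ℝ)) ^ 2) /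
      (‖z - c‖ ^ 2 + (1 / (n + 1 : ℝ)) ^ 2) ^ 2 * φ z := by
    have := ht.integral_log_norm_sq_add_mul hK (h := fun z => z - c)
      (fun z _ => by fun_prop) (δ := (1 / (n + 1 : ℝ)) ^ 2)
      (fun z _ => by have := hpos n; positivity)
    simpa using this
  refine tendsto_nhds_unique ?_ (integral_smooth_log_laplacian ht.cont hM c)
  simp only [← e1]
  -- A dominating function: the regularised logarithm lies between `log ‖z - c‖` and `log (‖z - c‖ ^
  -- 2 + 1) / 2`.
  have i1 : IntegrableOn (fun z => |Real.log ‖z - c‖| + Real.log (‖z - c‖ ^ 2 + 1) / 2) K := by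
    refine (integrableOn_log_norm_sub c hK).abs.add (Continuous.continuousOn ?_
      |>.integrableOn_compact hK)
    refine (Continuous.log (by fun_prop) fun z => ?_).div_const 2
    positivity
  have i2 : Integrable fun z => (|Real.log ‖z - c‖| + Real.log (‖z - c‖ ^ 2 + 1) / 2) *
      |dd 1 z + dd Complex.I z| := by
    have := ((ht.integrable_mul_dd hK i1 1).add (ht.integrable_mul_dd hK i1 Complex.I)).abs
    refine this.congr (Eventually.of_forall fun z => ?_)
    simp only [Pi.add_apply, ← mul_add, abs_mul]
    congr 1
    refine abs_of_nonneg (add_nonneg (abs_nonneg _) (div_nonneg (Real.log_nonneg ?_) two_pos.le))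
    nlinarith [sq_nonneg ‖z - c‖]
  refine tendsto_integral_of_dominated_convergence _ (fun n => ?_) i2
    (fun n => ?_) ?_
  · refine Continuous.aestronglyMeasurable (Continuous.mul (Continuous.div_const
      (Continuous.log (by fun_prop) fun z => ?_) 2) ((ht.cont_dd 1).add (ht.cont_dd _)))
    have := hpos n
    positivity
  · have : ∀ᵐ z : ℂ, z ≠ c := by simp [ae_iff]
    filter_upwards [this] with z hz
    rw [norm_mul, Real.norm_eq_abs, Real.norm_eq_abs]
    gcongr
    have hz' : 0 < ‖z - c‖ := norm_pos_iff.2 (sub_ne_zero.2 hz)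
    have hle : (1 / (n + 1 : ℝ)) ^ 2 ≤ 1 := by
      refine pow_le_one₀ (by positivity) ?_
      rw [div_le_one (by positivity)]
      linarith [(n.cast_nonneg : (0 : ℝ) ≤ n)]
    have l1 : Real.log ‖z - c‖ ≤ Real.log (‖z - c‖ ^ 2 + (1 / (n + 1 : ℝ)) ^ 2) / 2 := by
      rw [le_div_iff₀ two_pos, mul_comm, show (2 : ℝ) = (2 : ℕ) by norm_num, ← Real.log_pow]
      refine Real.log_le_log (by positivity) ?_
      linarith [hpos n]
    have l2 : Real.log (‖z - c‖ ^ 2 + (1 / (n + 1 : ℝ)) ^ 2) ≤ Real.log (‖z - c‖ ^ 2 + 1) :=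
      Real.log_le_log (by have := hpos n; positivity) (by linarith)
    have l3 : 0 ≤ Real.log (‖z - c‖ ^ 2 + 1) := Real.log_nonneg (by nlinarith [sq_nonneg ‖z - c‖])
    rw [abs_le]
    constructor
    · linarith [neg_abs_le (Real.log ‖z - c‖)]
    · linarith [abs_nonneg (Real.log ‖z - c‖)]
  · have : ∀ᵐ z : ℂ, z ≠ c := by simp [ae_iff]
    filter_upwards [this] with z hz
    refine Tendsto.mul_const _ ?_
    have hz' : 0 < ‖z - c‖ := norm_pos_iff.2 (sub_ne_zero.2 hz)
    have h1 : Tendsto (fun n : ℕ => ‖z - c‖ ^ 2 + (1 / (n + 1 : ℝ)) ^ 2) atTop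
        (𝓝 (‖z - c‖ ^ 2)) := by
      have := ((tendsto_one_div_add_atTop_nhds_zero_nat (𝕜 := ℝ)).pow 2).const_add (‖z - c‖ ^ 2)
      simpa using this
    have h2 := (h1.log (by positivity)).div_const 2
    simpa [Real.log_pow] using h2

/-! ### Dividing out zeros, and Green's formula for `log |f|` -/

lemma analyticOrderAt_ne_top_of_ball {f : ℂ → ℂ} (hf : AnalyticOnNhd ℂ f (Metric.ball 0 1))
    (h0 : f 0 ≠ 0) {c : ℂ} (hc : c ∈ Metric.ball (0 : ℂ) 1) : analyticOrderAt f c ≠ ⊤ := by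
  intro h
  rw [analyticOrderAt_eq_top] at h
  exact h0 (hf.eqOn_zero_of_preconnected_of_eventuallyEq_zero
    (convex_ball (0 : ℂ) 1).isPreconnected hc h (Metric.mem_ball_self one_pos))

/-- Finitely many zeros can be divided out of an analytic function. -/
lemma exists_eq_prod_mul {f : ℂ → ℂ} (hf : AnalyticOnNhd ℂ f (Metric.ball 0 1))
    (h0 : f 0 ≠ 0) (Z : Finset ℂ) (hZ : ∀ c ∈ Z, c ∈ Metric.ball (0 : ℂ) 1) :
    ∃ h : ℂ → ℂ, AnalyticOnNhd ℂ h (Metric.ball 0 1) ∧ (∀ c ∈ Z, h c ≠ 0) ∧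
      ∀ z, f z = (∏ c ∈ Z, (z - c) ^ analyticOrderNatAt f c) * h z := by
  classical
  induction Z using Finset.induction_on with
  | empty => exact ⟨f, hf, by simp, by simp⟩
  | insert c Z hcZ ih =>
    obtain ⟨h, hh, hne, hfh⟩ := ih fun c' hc' => hZ c' (Finset.mem_insert_of_mem hc')
    have hc := hZ c (Finset.mem_insert_self c Z)
    set m := analyticOrderNatAt f c
    have hP : AnalyticAt ℂ (fun z => ∏ c ∈ Z, (z - c) ^ analyticOrderNatAt f c) c := by fun_prop
    have hP0 : (∏ c' ∈ Z, (c - c') ^ analyticOrderNatAt f c') ≠ 0 :=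
      Finset.prod_ne_zero_iff.2 fun c' hc' => pow_ne_zero _ <| sub_ne_zero.2 fun h =>
        hcZ (h ▸ hc')
    have ho : analyticOrderAt h c = m := by
      have e : f = (fun z => ∏ c ∈ Z, (z - c) ^ analyticOrderNatAt f c) * h := funext hfh
      have e2 := analyticOrderAt_mul hP (hh c hc)
      rw [← e, hP.analyticOrderAt_eq_zero.2 hP0, zero_add] at e2
      rw [← e2, Nat.cast_analyticOrderNatAt (analyticOrderAt_ne_top_of_ball hf h0 hc)]
    obtain ⟨g, hg, hgc, hev⟩ := (hh c hc).analyticOrderAt_eq_natCast.1 ho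
    -- At `c` itself the quotient may be a division by `0`, so its value there is replaced by that
    -- of the local cofactor `g`.
    refine ⟨Function.update (fun z => h z / (z - c) ^ m) c (g c), fun z hz => ?_, fun c' hc' => ?_,
      fun z => ?_⟩
    · rcases eq_or_ne z c with rfl | hzc
      · refine hg.congr ?_
        filter_upwards [hev] with w hw
        rcases eq_or_ne w z with rfl | hwz
        · simp
        · have : (w - z) ^ m ≠ 0 := pow_ne_zero _ (sub_ne_zero.2 hwz)
          rw [Function.update_of_ne hwz, hw, smul_eq_mul, mul_div_cancel_left₀ _ this]
      · have : AnalyticAt ℂ (fun z => h z / (z - c) ^ m) z :=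
          (hh z hz).div (by fun_prop) (pow_ne_zero _ (sub_ne_zero.2 hzc))
        refine this.congr ?_
        filter_upwards [isOpen_ne.mem_nhds hzc] with w hw
        rw [Function.update_of_ne hw]
    · rcases eq_or_ne c' c with rfl | hne'
      · simpa using hgc
      · rw [Function.update_of_ne hne']
        exact div_ne_zero (hne c' ((Finset.mem_insert.1 hc').resolve_left hne'))
          (pow_ne_zero _ (sub_ne_zero.2 hne'))
    · rw [Finset.prod_insert hcZ, hfh z]
      rcases eq_or_ne z c with rfl | hzc
      · rw [Function.update_self, hev.self_of_nhds, smul_eq_mul]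
        ring
      · have : (z - c) ^ m ≠ 0 := pow_ne_zero _ (sub_ne_zero.2 hzc)
        rw [Function.update_of_ne hzc, mul_comm (_ ^ _), mul_assoc, mul_div_cancel₀ _ this]

lemma finite_zeros_inter_of_isCompact {f : ℂ → ℂ} (hf : AnalyticOnNhd ℂ f (Metric.ball 0 1))
    (h0 : f 0 ≠ 0) {K : Set ℂ} (hK : IsCompact K) (hKb : K ⊆ Metric.ball 0 1) :
    {z ∈ K | f z = 0}.Finite := by
  by_contra hinf
  obtain ⟨x, hxK, hx⟩ := Set.Infinite.exists_accPt_of_subset_isCompact hinf hK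
    (Set.sep_subset _ _)
  refine h0 (hf.eqOn_zero_of_preconnected_of_frequently_eq_zero
    (convex_ball (0 : ℂ) 1).isPreconnected (hKb hxK) ?_ (Metric.mem_ball_self one_pos))
  exact (accPt_iff_frequently_nhdsNE.1 hx).mono fun z hz => hz.2

/-- On a compact subset of the disc, `log |f|` splits into logarithmic kernels and a smooth
harmonic part. -/
lemma exists_log_norm_eq {f : ℂ → ℂ} (hf : AnalyticOnNhd ℂ f (Metric.ball 0 1))
    (h0 : f 0 ≠ 0) {K : Set ℂ} (hK : IsCompact K) (hKb : K ⊆ Metric.ball 0 1) :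
    ∃ (Z : Finset ℂ) (h : ℂ → ℂ), (∀ z, z ∈ Z ↔ z ∈ K ∧ f z = 0) ∧ AnalyticOnNhd ℂ h K ∧
      (∀ z ∈ K, h z ≠ 0) ∧ ∀ z ∈ K, z ∉ Z → Real.log ‖f z‖ =
        ∑ c ∈ Z, analyticOrderNatAt f c * Real.log ‖z - c‖ + Real.log ‖h z‖ := by
  have hfin := finite_zeros_inter_of_isCompact hf h0 hK hKb
  have hmem (z) : z ∈ hfin.toFinset ↔ z ∈ K ∧ f z = 0 := by simp
  obtain ⟨h, hh, hne, hfh⟩ := exists_eq_prod_mul hf h0 hfin.toFinset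
    fun c hc => hKb ((hmem c).1 hc).1
  have hne' : ∀ z ∈ K, h z ≠ 0 := fun z hz hhz => by
    by_cases hzZ : z ∈ hfin.toFinset
    · exact hne z hzZ hhz
    · exact hzZ ((hmem z).2 ⟨hz, by rw [hfh, hhz, mul_zero]⟩)
  refine ⟨hfin.toFinset, h, hmem, hh.mono hKb, hne', fun z hz hzZ => ?_⟩
  have hsub : ∀ c ∈ hfin.toFinset, z - c ≠ 0 := fun c hc h => hzZ (sub_eq_zero.1 h ▸ hc)
  rw [hfh z, norm_mul, norm_prod, Real.log_mul, Real.log_prod]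
  · simp [Real.log_pow]
  · exact fun c hc => norm_ne_zero_iff.2 (pow_ne_zero _ (hsub c hc))
  · exact Finset.prod_ne_zero_iff.2 fun c hc => norm_ne_zero_iff.2 (pow_ne_zero _ (hsub c hc))
  · exact norm_ne_zero_iff.2 (hne' z hz)

lemma ae_notMem_finset (Z : Finset ℂ) (μ : Measure ℂ) [NullSingletonClass μ] : ∀ᵐ z ∂μ, z ∉ Z := by
  simpa [ae_iff] using Z.finite_toSet.measure_zero μ

lemma integrableOn_log_norm {f : ℂ → ℂ} (hf : AnalyticOnNhd ℂ f (Metric.ball 0 1))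
    (h0 : f 0 ≠ 0) {K : Set ℂ} (hK : IsCompact K) (hKb : K ⊆ Metric.ball 0 1) :
    IntegrableOn (fun z => Real.log ‖f z‖) K := by
  obtain ⟨Z, h, -, hh, hne, hlog⟩ := exists_log_norm_eq hf h0 hK hKb
  have i1 : IntegrableOn (fun z => ∑ c ∈ Z, analyticOrderNatAt f c * Real.log ‖z - c‖ +
      Real.log ‖h z‖) K := by
    refine Integrable.add (integrable_finsetSum _ fun c _ =>
      (integrableOn_log_norm_sub c hK).const_mul _) (ContinuousOn.integrableOn_compact hK ?_)
    exact hh.continuousOn.norm.log fun z hz => norm_ne_zero_iff.2 (hne z hz)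
  refine i1.congr ?_
  filter_upwards [ae_restrict_mem hK.measurableSet, ae_notMem_finset Z _] with z hz hzZ
  exact (hlog z hz hzZ).symm

/-- Testing `log |f|` against the Laplacian of a test function counts the zeros of `f`. -/
lemma IsTestFunction.exists_integral_log_norm_mul {K : Set ℂ} {φ : ℂ → ℝ} {d dd : ℂ → ℂ → ℝ}
    (ht : IsTestFunction K φ d dd) (hK : IsCompact K) (hKb : K ⊆ Metric.ball 0 1) {f : ℂ → ℂ}
    (hf : AnalyticOnNhd ℂ f (Metric.ball 0 1)) (h0 : f 0 ≠ 0) :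
    ∃ Z : Finset ℂ, (∀ z, z ∈ Z ↔ z ∈ K ∧ f z = 0) ∧
      ∫ z, Real.log ‖f z‖ * (dd 1 z + dd Complex.I z) =
        logLaplacianMass * ∑ c ∈ Z, analyticOrderNatAt f c * φ c := by
  obtain ⟨Z, h, hZ, hh, hne, hlog⟩ := exists_log_norm_eq hf h0 hK hKb
  refine ⟨Z, hZ, ?_⟩
  have key {u : ℂ → ℝ} (hu : IntegrableOn u K) :
      Integrable fun z => u z * (dd 1 z + dd Complex.I z) := by
    simp only [mul_add]
    exact (ht.integrable_mul_dd hK hu 1).add (ht.integrable_mul_dd hK hu Complex.I)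
  have e1 : ∫ z, Real.log ‖f z‖ * (dd 1 z + dd Complex.I z) =
      ∫ z, (∑ c ∈ Z, analyticOrderNatAt f c * (Real.log ‖z - c‖ * (dd 1 z + dd Complex.I z)) +
        Real.log ‖h z‖ * (dd 1 z + dd Complex.I z)) := by
    refine integral_congr_ae ?_
    filter_upwards [ae_notMem_finset Z _] with z hzZ
    by_cases hz : z ∈ K
    · rw [hlog z hz hzZ, add_mul, Finset.sum_mul]
      simp only [mul_assoc]
    · simp [ht.dd_eq_zero _ z hz]
  rw [e1, integral_add, integral_finsetSum]
  · simp only [integral_const_mul, ht.integral_log_norm_sub_mul hK,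
      ht.integral_log_norm_mul_eq_zero hK hh hne, add_zero, Finset.mul_sum]
    exact Finset.sum_congr rfl fun c _ => by ring
  · exact fun c _ => (key (integrableOn_log_norm_sub c hK)).const_mul _
  · exact integrable_finsetSum _ fun c _ => (key (integrableOn_log_norm_sub c hK)).const_mul _
  · exact key ((hh.continuousOn.norm.log fun z hz =>
      norm_ne_zero_iff.2 (hne z hz)).integrableOn_compact hK)

/-! ### Polar coordinates -/

lemma polarCoord_symm_eq_circleMap (p : ℝ × ℝ) :
    Complex.polarCoord.symm p = circleMap 0 p.1 p.2 := by
  rw [Complex.polarCoord_symm_apply, circleMap, Complex.exp_mul_I]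
  simp

lemma continuous_complexPolarCoord_symm : Continuous Complex.polarCoord.symm := by
  have : (Complex.polarCoord.symm : ℝ × ℝ → ℂ) =
      fun p => (p.1 : ℂ) * (Real.cos p.2 + Real.sin p.2 * Complex.I) :=
    funext Complex.polarCoord_symm_apply
  rw [this]
  fun_prop

lemma integrable_iff_integrableOn_polarCoord {g : ℂ → ℝ} (hg : Measurable g) :
    Integrable g ↔ IntegrableOn (fun p : ℝ × ℝ => p.1 * g (circleMap 0 p.1 p.2))
      (Set.Ioi 0 ×ˢ Set.Ioo (-Real.pi) Real.pi) := by
  have hm : Measurable fun p : ℝ × ℝ => p.1 * g (circleMap 0 p.1 p.2) := by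
    simp only [← polarCoord_symm_eq_circleMap]
    exact measurable_fst.mul (hg.comp continuous_complexPolarCoord_symm.measurable)
  unfold IntegrableOn
  rw [Integrable, Integrable, and_iff_right hg.aestronglyMeasurable,
    and_iff_right hm.aestronglyMeasurable, HasFiniteIntegral, HasFiniteIntegral,
    ← Complex.lintegral_comp_polarCoord_symm, polarCoord_target]
  have : ∫⁻ p in Set.Ioi (0 : ℝ) ×ˢ Set.Ioo (-Real.pi) Real.pi,
      ENNReal.ofReal p.1 • ‖g (Complex.polarCoord.symm p)‖ₑ =
      ∫⁻ p in Set.Ioi (0 : ℝ) ×ˢ Set.Ioo (-Real.pi) Real.pi,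
        ‖p.1 * g (circleMap 0 p.1 p.2)‖ₑ := by
    refine setLIntegral_congr_fun (measurableSet_Ioi.prod measurableSet_Ioo) fun p hp => ?_
    rw [enorm_mul, polarCoord_symm_eq_circleMap, Real.enorm_of_nonneg (le_of_lt hp.1), smul_eq_mul]
  rw [this]

/-- Jensen's formula: the average is `log ‖f 0‖ = 0` plus a sum of multiplicities times `log (r /
‖u‖) ≥ 0`. -/
lemma circleAverage_log_norm_nonneg {f : ℂ → ℂ} {r : ℝ} (hr : 0 < r)
    (hf : AnalyticOnNhd ℂ f (Metric.closedBall 0 r)) (h0 : ‖f 0‖ = 1) :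
    0 ≤ Real.circleAverage (fun z => Real.log ‖f z‖) 0 r := by
  rw [← abs_of_pos hr] at hf
  have hne : f 0 ≠ 0 := norm_ne_zero_iff.1 (by simp [h0])
  rw [hf.circleAverage_log_norm hr.ne' hne, h0, Real.log_one, add_zero]
  refine finsum_nonneg fun u => ?_
  by_cases hu : u ∈ Metric.closedBall (0 : ℂ) |r|
  · refine mul_nonneg ?_ ?_
    · exact_mod_cast MeromorphicOn.AnalyticOnNhd.divisor_nonneg hf u
    · rw [abs_of_pos hr, mem_closedBall_zero_iff] at hu
      rcases eq_or_ne u 0 with rfl | hu0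
      · simp
      · rw [zero_sub, norm_neg]
        refine Real.log_nonneg ?_
        rw [← div_eq_mul_inv, one_le_div (norm_pos_iff.2 hu0)]
        exact hu
  · rw [Function.locallyFinsuppWithin.apply_eq_zero_of_notMem _ hu]
    simp

/-- The area mean of `log |f|` over a disc centred at the origin is nonnegative if `|f 0| = 1`. -/
lemma integral_ball_log_norm_nonneg {f : ℂ → ℂ} (hf : AnalyticOnNhd ℂ f (Metric.ball 0 1))
    (h0 : ‖f 0‖ = 1) {r : ℝ} (hr : r < 1) :
    0 ≤ ∫ z in Metric.ball (0 : ℂ) r, Real.log ‖f z‖ := by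
  have hne : f 0 ≠ 0 := norm_ne_zero_iff.1 (by simp [h0])
  have hi : IntegrableOn (fun z => Real.log ‖f z‖) (Metric.ball 0 r) :=
    (integrableOn_log_norm hf hne (isCompact_closedBall 0 r)
      (Metric.closedBall_subset_ball hr)).mono_set Metric.ball_subset_closedBall
  set g := (Metric.ball (0 : ℂ) r).indicator fun z => Real.log ‖f z‖
  have hgm : Measurable g := by
    classical
    have h1 : Measurable ((Metric.ball (0 : ℂ) r).piecewise f 0) :=
      ContinuousOn.measurable_piecewise
        (hf.continuousOn.mono (Metric.ball_subset_ball hr.le)) continuousOn_const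
        measurableSet_ball
    have h2 : g = fun z => Real.log ‖(Metric.ball (0 : ℂ) r).piecewise f 0 z‖ := by
      ext z
      by_cases hz : z ∈ Metric.ball (0 : ℂ) r <;> simp [g, Set.piecewise, hz]
    rw [h2]
    exact Real.measurable_log.comp h1.norm
  have hgi : Integrable g := (integrable_indicator_iff measurableSet_ball).2 hi
  rw [← integral_indicator measurableSet_ball]
  change 0 ≤ ∫ z, g z
  have hpi := (integrable_iff_integrableOn_polarCoord hgm).1 hgi
  rw [← Complex.integral_comp_polarCoord_symm, polarCoord_target]
  simp only [polarCoord_symm_eq_circleMap, smul_eq_mul]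
  rw [Measure.volume_eq_prod] at hpi ⊢
  rw [setIntegral_prod _ hpi]
  refine setIntegral_nonneg measurableSet_Ioi fun t ht => ?_
  rw [Set.mem_Ioi] at ht
  rw [integral_const_mul]
  refine mul_nonneg ht.le ?_
  by_cases htr : t < r
  · have e (θ : ℝ) : g (circleMap 0 t θ) = Real.log ‖f (circleMap 0 t θ)‖ := by
      refine Set.indicator_of_mem ?_ _
      simpa [abs_of_pos ht] using htr
    simp only [e]
    rw [← integral_Ioc_eq_integral_Ioo, ← intervalIntegral.integral_of_le
      (by linarith [Real.pi_pos])]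
    -- Polar coordinates use the angles `(-π, π)`, circle averages `(0, 2π)`; periodicity identifies
    -- the two integrals.
    have hper : Function.Periodic (fun θ => Real.log ‖f (circleMap 0 t θ)‖) (2 * Real.pi) :=
      fun θ => by simp only [periodic_circleMap 0 t θ]
    have e2 := hper.intervalIntegral_add_eq (-Real.pi) 0
    rw [show -Real.pi + 2 * Real.pi = Real.pi by ring, zero_add] at e2
    rw [e2]
    have := circleAverage_log_norm_nonneg ht
      (hf.mono (Metric.closedBall_subset_ball (htr.trans hr))) h0
    rw [Real.circleAverage_def, smul_eq_mul] at this
    exact (mul_nonneg_iff_of_pos_left (by have := Real.pi_pos; positivity)).1 this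
  · have e (θ : ℝ) : g (circleMap 0 t θ) = 0 := by
      refine Set.indicator_of_notMem ?_ _
      simpa [abs_of_pos ht] using htr
    simp [e]

/-! ### The test weight and its Laplacian -/

/-- The weight `(1 - |z|²) ^ s * |G z|²`, cut off near the unit circle. -/
noncomputable def weightTest (s δ : ℝ) (G : ℂ → ℂ) (z : ℂ) : ℝ :=
  cutPow s δ (1 - ‖z‖ ^ 2) * ‖G z‖ ^ 2

/-- The derivative of `weightTest` in the direction `e`. -/
noncomputable def weightTest₁ (s δ : ℝ) (G : ℂ → ℂ) (e z : ℂ) : ℝ :=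
  cutPow₁ s δ (1 - ‖z‖ ^ 2) * (-(2 * inner ℝ z e)) * ‖G z‖ ^ 2 +
    cutPow s δ (1 - ‖z‖ ^ 2) * (2 * inner ℝ (G z) (e * deriv G z))

/-- The second derivative of `weightTest` in the direction `e`. -/
noncomputable def weightTest₂ (s δ : ℝ) (G : ℂ → ℂ) (e z : ℂ) : ℝ :=
  cutPow₂ s δ (1 - ‖z‖ ^ 2) * (2 * inner ℝ z e) ^ 2 * ‖G z‖ ^ 2 -
    cutPow₁ s δ (1 - ‖z‖ ^ 2) * (2 * ‖e‖ ^ 2) * ‖G z‖ ^ 2 -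
    cutPow₁ s δ (1 - ‖z‖ ^ 2) * (8 * inner ℝ z e * inner ℝ (G z) (e * deriv G z)) +
    cutPow s δ (1 - ‖z‖ ^ 2) *
      (2 * (‖e * deriv G z‖ ^ 2 + inner ℝ (G z) (e * (e * deriv (deriv G) z))))

section cutZero

variable {s δ v : ℝ}

lemma cutPow_eq_zero (h : v ≤ δ) : cutPow s δ v = 0 := by
  simp [cutPow, max_eq_right (sub_nonpos.2 h)]

lemma cutPow₁_eq_zero (h : v ≤ δ) : cutPow₁ s δ v = 0 := by
  simp [cutPow₁, max_eq_right (sub_nonpos.2 h)]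

lemma cutPow₂_eq_zero (h : v ≤ δ) : cutPow₂ s δ v = 0 := by
  simp [cutPow₂, max_eq_right (sub_nonpos.2 h)]

end cutZero

lemma continuousAt_cutPow₂ {s δ v : ℝ} (hv : 0 < v) : ContinuousAt (cutPow₂ s δ) v := by
  have h (a : ℝ) : ContinuousAt (fun v : ℝ => v ^ a) v :=
    Real.continuousAt_rpow_const _ _ (Or.inl hv.ne')
  have hm : ContinuousAt (fun v : ℝ => max (v - δ) 0) v := by fun_prop
  exact (((continuousAt_const.mul (h _)).mul hm).add
    ((continuousAt_const.mul (h _)).mul (hm.pow 2))).add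
    ((continuousAt_const.mul (h _)).mul (hm.pow 3))

section

variable {s δ : ℝ} {G : ℂ → ℂ}

lemma one_sub_norm_sq_pos {z : ℂ} (hz : z ∈ Metric.ball (0 : ℂ) 1) : 0 < 1 - ‖z‖ ^ 2 := by
  rw [mem_ball_zero_iff] at hz
  nlinarith [norm_nonneg z]

lemma hasDerivAt_one_sub_norm_sq_line (z e : ℂ) :
    HasDerivAt (fun t : ℝ => 1 - ‖z + t • e‖ ^ 2) (-(2 * inner ℝ z e)) 0 := by
  simpa using ((hasDerivAt_id z).comp_line e).norm_sq.const_sub 1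

lemma hasLineDerivAt_weightTest (hG : AnalyticOnNhd ℂ G (Metric.ball 0 1)) {z : ℂ}
    (hz : z ∈ Metric.ball (0 : ℂ) 1) (e : ℂ) :
    HasLineDerivAt ℝ (weightTest s δ G) (weightTest₁ s δ G e z) z e := by
  have h1 : HasDerivAt (cutPow s δ) (cutPow₁ s δ (1 - ‖z‖ ^ 2)) (1 - ‖z + (0 : ℝ) • e‖ ^ 2) := by
    simpa using hasDerivAt_cutPow (s := s) (δ := δ) (one_sub_norm_sq_pos hz)
  have h2 := h1.comp (0 : ℝ) (hasDerivAt_one_sub_norm_sq_line z e)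
  have h3 := ((hG z hz).differentiableAt.hasDerivAt.comp_line e).norm_sq
  refine (h2.mul h3).congr_deriv ?_
  simp [weightTest₁]

lemma hasLineDerivAt_weightTest₁ (hG : AnalyticOnNhd ℂ G (Metric.ball 0 1)) {z : ℂ}
    (hz : z ∈ Metric.ball (0 : ℂ) 1) (e : ℂ) :
    HasLineDerivAt ℝ (weightTest₁ s δ G e) (weightTest₂ s δ G e z) z e := by
  have h1 : HasDerivAt (cutPow s δ) (cutPow₁ s δ (1 - ‖z‖ ^ 2)) (1 - ‖z + (0 : ℝ) • e‖ ^ 2) := by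
    simpa using hasDerivAt_cutPow (s := s) (δ := δ) (one_sub_norm_sq_pos hz)
  have h1' : HasDerivAt (cutPow₁ s δ) (cutPow₂ s δ (1 - ‖z‖ ^ 2))
      (1 - ‖z + (0 : ℝ) • e‖ ^ 2) := by
    simpa using hasDerivAt_cutPow₁ (s := s) (δ := δ) (one_sub_norm_sq_pos hz)
  have h2 := h1.comp (0 : ℝ) (hasDerivAt_one_sub_norm_sq_line z e)
  have h2' := h1'.comp (0 : ℝ) (hasDerivAt_one_sub_norm_sq_line z e)
  have h3 := ((hG z hz).differentiableAt.hasDerivAt.comp_line e).norm_sq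
  have h4 := ((hG z hz).differentiableAt.hasDerivAt.comp_line e).inner ℝ
    (((hG z hz).deriv.differentiableAt.hasDerivAt.comp_line e).const_mul e)
  have h5 := ((((hasDerivAt_id z).comp_line e).inner ℝ (hasDerivAt_const (0 : ℝ) e)).const_mul
    2).neg
  refine (((h2'.mul h5).mul h3).add (h2.mul (h4.const_mul 2))).congr_deriv ?_
  simp only [weightTest₂, Function.comp, id, zero_smul, add_zero, mul_one, inner_zero_right,
    zero_add, real_inner_self_eq_norm_sq, Pi.neg_apply, Pi.mul_apply]
  ring

lemma continuousOn_ball_weight (hG : AnalyticOnNhd ℂ G (Metric.ball 0 1)) :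
    ContinuousOn (weightTest s δ G) (Metric.ball 0 1) ∧
    (∀ e, ContinuousOn (weightTest₁ s δ G e) (Metric.ball 0 1)) ∧
    (∀ e, ContinuousOn (weightTest₂ s δ G e) (Metric.ball 0 1)) := by
  have c0 := hG.continuousOn
  have c1 := hG.deriv.continuousOn
  have c2 := hG.deriv.deriv.continuousOn
  have hN : ContinuousOn (fun z : ℂ => 1 - ‖z‖ ^ 2) (Metric.ball 0 1) := by fun_prop
  have k0 : ContinuousOn (fun z : ℂ => cutPow s δ (1 - ‖z‖ ^ 2)) (Metric.ball 0 1) :=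
    fun z hz => ((hasDerivAt_cutPow (one_sub_norm_sq_pos hz)).continuousAt).comp_continuousWithinAt
      (f := fun z : ℂ => 1 - ‖z‖ ^ 2) (hN z hz)
  have k1 : ContinuousOn (fun z : ℂ => cutPow₁ s δ (1 - ‖z‖ ^ 2)) (Metric.ball 0 1) :=
    fun z hz => ((hasDerivAt_cutPow₁ (one_sub_norm_sq_pos hz)).continuousAt).comp_continuousWithinAt
      (f := fun z : ℂ => 1 - ‖z‖ ^ 2) (hN z hz)
  have k2 : ContinuousOn (fun z : ℂ => cutPow₂ s δ (1 - ‖z‖ ^ 2)) (Metric.ball 0 1) :=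
    fun z hz => (continuousAt_cutPow₂ (one_sub_norm_sq_pos hz)).comp_continuousWithinAt
      (f := fun z : ℂ => 1 - ‖z‖ ^ 2) (hN z hz)
  have i0 (e : ℂ) : ContinuousOn (fun z : ℂ => (inner ℝ z e : ℝ)) (Metric.ball 0 1) := by fun_prop
  have i1 (e : ℂ) : ContinuousOn (fun z : ℂ => (inner ℝ (G z) (e * deriv G z) : ℝ))
      (Metric.ball 0 1) := c0.inner (continuousOn_const.mul c1)
  have i2 (e : ℂ) : ContinuousOn (fun z : ℂ => (inner ℝ (G z) (e * (e * deriv (deriv G) z)) : ℝ))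
      (Metric.ball 0 1) := c0.inner (continuousOn_const.mul (continuousOn_const.mul c2))
  refine ⟨?_, fun e => ?_, fun e => ?_⟩
  · unfold weightTest; fun_prop
  · have := i0 e; have := i1 e
    unfold weightTest₁; fun_prop
  · have := i0 e; have := i1 e; have := i2 e
    unfold weightTest₂; fun_prop

/-- Off the open disc `1 - ‖z‖ ^ 2 ≤ 0 < δ`, so `g` vanishes on a whole neighbourhood of each such
point. -/
lemma continuous_of_continuousOn_ball_of_eq_zero (hδ : 0 < δ) {g : ℂ → ℝ}
    (hg : ContinuousOn g (Metric.ball 0 1)) (h0 : ∀ z : ℂ, 1 - ‖z‖ ^ 2 ≤ δ → g z = 0) :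
    Continuous g := by
  rw [continuous_iff_continuousAt]
  intro z
  by_cases hz : z ∈ Metric.ball (0 : ℂ) 1
  · exact hg.continuousAt (Metric.isOpen_ball.mem_nhds hz)
  · refine (continuousAt_const (y := (0 : ℝ))).congr ?_
    have : 1 - ‖z‖ ^ 2 < δ := by
      rw [mem_ball_zero_iff, not_lt] at hz
      nlinarith
    have hc : Continuous fun z : ℂ => 1 - ‖z‖ ^ 2 := by fun_prop
    filter_upwards [hc.continuousAt.eventually_lt_const this] with w hw
    exact (h0 w hw.le).symm

lemma hasLineDerivAt_zero_of_eq_zero {g : ℂ → ℝ} {z e : ℂ}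
    (h0 : ∀ z : ℂ, 1 - ‖z‖ ^ 2 ≤ δ → g z = 0) (hz : 1 - ‖z‖ ^ 2 < δ) :
    HasLineDerivAt ℝ g 0 z e := by
  refine (hasDerivAt_const (0 : ℝ) (0 : ℝ)).congr_of_eventuallyEq ?_
  have hc : Continuous fun t : ℝ => 1 - ‖z + t • e‖ ^ 2 := by fun_prop
  filter_upwards [hc.continuousAt.eventually_lt_const (u := δ) (by simpa using hz)] with t ht
  exact h0 _ ht.le

/-- `weightTest` is a test function supported in a smaller closed disc. -/
lemma isTestFunction_weightTest (hδ : 0 < δ)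
    (hG : AnalyticOnNhd ℂ G (Metric.ball 0 1)) :
    IsTestFunction (Metric.closedBall 0 √(1 - δ)) (weightTest s δ G) (weightTest₁ s δ G)
      (weightTest₂ s δ G) := by
  have z0 : ∀ z : ℂ, 1 - ‖z‖ ^ 2 ≤ δ → weightTest s δ G z = 0 := fun z hz => by
    simp [weightTest, cutPow_eq_zero hz]
  have z1 : ∀ e, ∀ z : ℂ, 1 - ‖z‖ ^ 2 ≤ δ → weightTest₁ s δ G e z = 0 := fun e z hz => by
    simp [weightTest₁, cutPow_eq_zero hz, cutPow₁_eq_zero hz]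
  have z2 : ∀ e, ∀ z : ℂ, 1 - ‖z‖ ^ 2 ≤ δ → weightTest₂ s δ G e z = 0 := fun e z hz => by
    simp [weightTest₂, cutPow_eq_zero hz, cutPow₁_eq_zero hz, cutPow₂_eq_zero hz]
  have hK : ∀ z : ℂ, z ∉ Metric.closedBall 0 √(1 - δ) → 1 - ‖z‖ ^ 2 ≤ δ := fun z hz => by
    rw [mem_closedBall_zero_iff, not_le] at hz
    have := (Real.sqrt_lt' (lt_of_le_of_lt (Real.sqrt_nonneg _) hz)).1 hz
    linarith
  have hb : ∀ z : ℂ, z ∉ Metric.ball 0 1 → 1 - ‖z‖ ^ 2 < δ := fun z hz => by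
    rw [mem_ball_zero_iff, not_lt] at hz
    nlinarith
  obtain ⟨c0, c1, c2⟩ := continuousOn_ball_weight (s := s) (δ := δ) hG
  refine ⟨fun z hz => z0 z (hK z hz), fun e z hz => z1 e z (hK z hz),
    fun e z hz => z2 e z (hK z hz), fun e z => ?_, fun e z => ?_,
    continuous_of_continuousOn_ball_of_eq_zero hδ c0 z0,
    fun e => continuous_of_continuousOn_ball_of_eq_zero hδ (c1 e) (z1 e),
    fun e => continuous_of_continuousOn_ball_of_eq_zero hδ (c2 e) (z2 e)⟩
  · by_cases hz : z ∈ Metric.ball (0 : ℂ) 1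
    · exact hasLineDerivAt_weightTest hG hz e
    · rw [z1 e z (hb z hz).le]
      exact hasLineDerivAt_zero_of_eq_zero z0 (hb z hz)
  · by_cases hz : z ∈ Metric.ball (0 : ℂ) 1
    · exact hasLineDerivAt_weightTest₁ hG hz e
    · rw [z2 e z (hb z hz).le]
      exact hasLineDerivAt_zero_of_eq_zero (z1 e) (hb z hz)

/-- Holomorphy of `G` gives `Δ|G|² = 4 |G'|²`, so `G''` disappears and only the logarithmic
derivative `ℓ` remains. -/
lemma laplacian_weightTest {ℓ z : ℂ} (hℓ : deriv G z = ℓ * G z) :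
    weightTest₂ s δ G 1 z + weightTest₂ s δ G Complex.I z =
      4 * ‖G z‖ ^ 2 * (cutPow₂ s δ (1 - ‖z‖ ^ 2) * ‖z‖ ^ 2 -
        cutPow₁ s δ (1 - ‖z‖ ^ 2) * (1 + 2 * (z * ℓ).re) +
        cutPow s δ (1 - ‖z‖ ^ 2) * ‖ℓ‖ ^ 2) := by
  unfold weightTest₂
  rw [hℓ]
  generalize cutPow₂ s δ (1 - ‖z‖ ^ 2) = a
  generalize cutPow₁ s δ (1 - ‖z‖ ^ 2) = b
  generalize cutPow s δ (1 - ‖z‖ ^ 2) = c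
  generalize G z = g
  generalize deriv (deriv G) z = k
  simp only [Complex.inner, ← Complex.normSq_eq_norm_sq, Complex.normSq_apply]
  simp
  ring

/-- Writing `v = 1 - ‖z‖ ^ 2`, the second-derivative term is at least `(s - 1) ‖z‖ ^ 2 / v` times
`cutPow₁`, which beats `1 + 2 A` near the circle. Only an upper bound on `Re (z ℓ)` enters. -/
lemma laplacian_weightTest_nonneg {A : ℝ} {ℓ z : ℂ} (hs : 1 < s) (hδ : 0 < δ)
    (hz : z ∈ Metric.ball (0 : ℂ) 1) (hℓ : deriv G z = ℓ * G z) (hA : (z * ℓ).re ≤ A)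
    (hx : (1 + 2 * A) * (1 - ‖z‖ ^ 2) ≤ (s - 1) * ‖z‖ ^ 2) :
    0 ≤ weightTest₂ s δ G 1 z + weightTest₂ s δ G Complex.I z := by
  rw [laplacian_weightTest hℓ]
  have hv := one_sub_norm_sq_pos hz
  have h1 := sub_one_mul_cutPow₁_le hs hδ hv
  have h2 := cutPow₁_nonneg hs hδ hv
  have h3 : 0 ≤ cutPow s δ (1 - ‖z‖ ^ 2) := cutPow_nonneg hv.le
  set v := 1 - ‖z‖ ^ 2
  have h4 : cutPow₁ s δ v * (1 + 2 * (z * ℓ).re) ≤ cutPow₁ s δ v * (1 + 2 * A) := by gcongr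
  have h5 : cutPow₁ s δ v * (1 + 2 * A) ≤ cutPow₂ s δ v * ‖z‖ ^ 2 := by
    refine le_of_mul_le_mul_left ?_ hv
    nlinarith [mul_le_mul_of_nonneg_left hx h2, mul_le_mul_of_nonneg_right h1 (sq_nonneg ‖z‖)]
  have h6 : 0 ≤ cutPow s δ v * ‖ℓ‖ ^ 2 := by positivity
  have : 0 ≤ cutPow₂ s δ v * ‖z‖ ^ 2 - cutPow₁ s δ v * (1 + 2 * (z * ℓ).re) +
      cutPow s δ v * ‖ℓ‖ ^ 2 := by linarith
  positivity

/-- The constant in `abs_laplacian_weightTest_le`. -/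
noncomputable def laplacianConst (s B : ℝ) : ℝ :=
  4 * ((6 + 6 * (s + 3) + (s + 3) * (s + 4)) + (s + 3) * (1 + 2 * B) + B ^ 2)

/-- Each derivative of the profile costs a factor `1 / v`, and so does each `ℓ`, since `‖ℓ‖ ≤ B /
v`; every term therefore has size `v ^ (s - 2)`. -/
lemma abs_laplacian_weightTest_le {B : ℝ} {ℓ z : ℂ} (hs : 1 < s) (hδ : 0 < δ)
    (hz : z ∈ Metric.ball (0 : ℂ) 1) (hℓ : deriv G z = ℓ * G z)
    (hB : ‖ℓ‖ * (1 - ‖z‖ ^ 2) ≤ B) :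
    |weightTest₂ s δ G 1 z + weightTest₂ s δ G Complex.I z| ≤
      laplacianConst s B * (‖G z‖ ^ 2 * (1 - ‖z‖ ^ 2) ^ (s - 2)) := by
  rw [laplacian_weightTest hℓ]
  have hv := one_sub_norm_sq_pos hz
  have hz1 : ‖z‖ ≤ 1 := (mem_ball_zero_iff.1 hz).le
  have hv1 : 1 - ‖z‖ ^ 2 ≤ 1 := by linarith [sq_nonneg ‖z‖]
  have h0 := cutPow_le (s := s) hδ hv
  have h0' : 0 ≤ cutPow s δ (1 - ‖z‖ ^ 2) := cutPow_nonneg hv.le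
  have h1 := cutPow₁_le hs hδ hv
  have h1' := cutPow₁_nonneg hs hδ hv
  have h2 := abs_cutPow₂_le hs hδ hv
  set v := 1 - ‖z‖ ^ 2
  have r1 : v ^ (s - 1) = v ^ (s - 2) * v := by
    rw [← Real.rpow_add_one hv.ne']; congr 1; ring
  have r0 : v ^ s = v ^ (s - 2) * v ^ 2 := by
    rw [← Real.rpow_natCast, ← Real.rpow_add hv]; congr 1; push_cast; ring
  have hp : 0 ≤ v ^ (s - 2) := by positivity
  have hB0 : 0 ≤ B := le_trans (by positivity) hB
  have t2 : |cutPow₂ s δ v * ‖z‖ ^ 2| ≤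
      (6 + 6 * (s + 3) + (s + 3) * (s + 4)) * v ^ (s - 2) := by
    rw [abs_mul, abs_of_nonneg (sq_nonneg ‖z‖)]
    refine (mul_le_of_le_one_right (abs_nonneg _) ?_).trans h2
    exact pow_le_one₀ (norm_nonneg z) hz1
  have t1 : |cutPow₁ s δ v * (1 + 2 * (z * ℓ).re)| ≤ (s + 3) * (1 + 2 * B) * v ^ (s - 2) := by
    have e1 : |1 + 2 * (z * ℓ).re| ≤ 1 + 2 * ‖ℓ‖ := by
      have : |(z * ℓ).re| ≤ ‖ℓ‖ := (Complex.abs_re_le_norm _).trans (by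
        rw [norm_mul]; exact mul_le_of_le_one_left (norm_nonneg _) hz1)
      rw [abs_le] at this ⊢
      constructor <;> linarith
    rw [abs_mul, abs_of_nonneg h1']
    calc _ ≤ (s + 3) * v ^ (s - 1) * (1 + 2 * ‖ℓ‖) := by gcongr
      _ = (s + 3) * v ^ (s - 2) * (v + 2 * (‖ℓ‖ * v)) := by rw [r1]; ring
      _ ≤ (s + 3) * v ^ (s - 2) * (1 + 2 * B) := by gcongr
      _ = _ := by ring
  have t0 : |cutPow s δ v * ‖ℓ‖ ^ 2| ≤ B ^ 2 * v ^ (s - 2) := by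
    rw [abs_of_nonneg (by positivity)]
    calc _ ≤ v ^ s * ‖ℓ‖ ^ 2 := by gcongr
      _ = v ^ (s - 2) * (‖ℓ‖ * v) ^ 2 := by rw [r0]; ring
      _ ≤ v ^ (s - 2) * B ^ 2 := by gcongr
      _ = _ := by ring
  rw [abs_mul, abs_of_nonneg (by positivity)]
  calc _ ≤ 4 * ‖G z‖ ^ 2 * (|cutPow₂ s δ v * ‖z‖ ^ 2| +
        |cutPow₁ s δ v * (1 + 2 * (z * ℓ).re)| + |cutPow s δ v * ‖ℓ‖ ^ 2|) := by
        gcongr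
        exact (abs_add_le _ _).trans (add_le_add_left (abs_sub _ _) _)
    _ ≤ 4 * ‖G z‖ ^ 2 * ((6 + 6 * (s + 3) + (s + 3) * (s + 4)) * v ^ (s - 2) +
        (s + 3) * (1 + 2 * B) * v ^ (s - 2) + B ^ 2 * v ^ (s - 2)) := by gcongr
    _ = _ := by rw [laplacianConst]; ring

end

/-! ### The weighted Blaschke bound -/

/-- A weighted Blaschke condition: if `log |f| ≤ D V` in the disc, then the zeros of `f` are summable
against `(1 - |z|²) ^ s * |G z|²`, provided that `V |G|² (1 - |z|²) ^ (s - 2)` is integrable and the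
logarithmic derivative `ℓ` of `G` is under control. -/
theorem exists_weighted_blaschke_bound {s A B : ℝ} {G ℓ : ℂ → ℂ} {V : ℂ → ℝ} (hs : 1 < s)
    (hA0 : 0 ≤ A)
    (hG : AnalyticOnNhd ℂ G (Metric.ball 0 1))
    (hℓ : ∀ z ∈ Metric.ball (0 : ℂ) 1, deriv G z = ℓ z * G z)
    (hA : ∀ z ∈ Metric.ball (0 : ℂ) 1, (z * ℓ z).re ≤ A)
    (hB : ∀ z ∈ Metric.ball (0 : ℂ) 1, ‖ℓ z‖ * (1 - ‖z‖ ^ 2) ≤ B)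
    (hV : ContinuousOn V (Metric.ball 0 1)) (hV0 : ∀ z ∈ Metric.ball (0 : ℂ) 1, 0 ≤ V z)
    (hW : IntegrableOn (fun z => V z * (‖G z‖ ^ 2 * (1 - ‖z‖ ^ 2) ^ (s - 2)))
      (Metric.ball 0 1)) :
    ∃ C : ℝ, 0 ≤ C ∧ ∀ (f : ℂ → ℂ) (D : ℝ), AnalyticOnNhd ℂ f (Metric.ball 0 1) → ‖f 0‖ = 1 →
      0 ≤ D → (∀ z ∈ Metric.ball (0 : ℂ) 1, Real.log ‖f z‖ ≤ D * V z) →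
      ∀ F : Finset ℂ, (∀ c ∈ F, c ∈ diskZeros f) →
        ∑ c ∈ F, analyticOrderNatAt f c * ((1 - ‖c‖ ^ 2) ^ s * ‖G c‖ ^ 2) ≤ C * D := by
  -- `ρ ^ 2 = (1 + 2 A) / (s + 2 A)` is the case of equality; it is below `1` exactly because `s >
  -- 1`.
  obtain ⟨ρ, hρ0, hρ1, hρ⟩ : ∃ ρ : ℝ, 0 < ρ ∧ ρ < 1 ∧ ∀ x, ρ ≤ x → x < 1 →
      (1 + 2 * A) * (1 - x ^ 2) ≤ (s - 1) * x ^ 2 := by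
    have hx0 : 0 < (1 + 2 * A) / (s + 2 * A) := by positivity
    have hx1 : (1 + 2 * A) / (s + 2 * A) < 1 := by
      rw [div_lt_one (by linarith)]; linarith
    refine ⟨√((1 + 2 * A) / (s + 2 * A)), Real.sqrt_pos.2 hx0, ?_, fun x hx _ => ?_⟩
    · rw [Real.sqrt_lt' one_pos]; simpa using hx1
    · have h1 : (1 + 2 * A) / (s + 2 * A) ≤ x ^ 2 := by
        have := pow_le_pow_left₀ (Real.sqrt_nonneg _) hx 2
        rwa [Real.sq_sqrt hx0.le] at this
      rw [div_le_iff₀ (by linarith)] at h1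
      linarith
  have hKρ : Metric.closedBall (0 : ℂ) ρ ⊆ Metric.ball 0 1 := Metric.closedBall_subset_ball hρ1
  have hbρ : Metric.ball (0 : ℂ) ρ ⊆ Metric.ball 0 1 := Metric.ball_subset_ball hρ1.le
  have hc : ContinuousOn (fun z => ‖G z‖ ^ 2 * (1 - ‖z‖ ^ 2) ^ (s - 2)) (Metric.ball 0 1) := by
    refine (hG.continuousOn.norm.pow 2).mul (ContinuousOn.rpow_const (by fun_prop) fun z hz => ?_)
    exact Or.inl (one_sub_norm_sq_pos hz).ne'
  obtain ⟨M, hM⟩ := (isCompact_closedBall (0 : ℂ) ρ).exists_bound_of_continuousOn (hc.mono hKρ)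
  have hM0 : 0 ≤ M := (norm_nonneg _).trans (hM 0 (Metric.mem_closedBall_self hρ0.le))
  have hB0 : 0 ≤ B := le_trans (by simp) (hB 0 (Metric.mem_ball_self one_pos))
  set Λ := laplacianConst s B
  have hΛ : 0 ≤ Λ := by
    have : 0 < s + 3 := by linarith
    have : 0 < s + 4 := by linarith
    unfold Λ laplacianConst
    positivity
  set W : ℂ → ℝ := fun z => V z * (‖G z‖ ^ 2 * (1 - ‖z‖ ^ 2) ^ (s - 2))
  have hW0 : ∀ z ∈ Metric.ball (0 : ℂ) 1, 0 ≤ W z := fun z hz =>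
    mul_nonneg (hV0 z hz) (mul_nonneg (sq_nonneg _)
      (Real.rpow_nonneg (one_sub_norm_sq_pos hz).le _))
  have hVi : IntegrableOn V (Metric.ball 0 ρ) :=
    ((hV.mono hKρ).integrableOn_compact (isCompact_closedBall 0 ρ)).mono_set
      Metric.ball_subset_closedBall
  have hIV : 0 ≤ ∫ z in Metric.ball 0 ρ, V z :=
    setIntegral_nonneg measurableSet_ball fun z hz => hV0 z (hbρ hz)
  have hIW : 0 ≤ ∫ z in Metric.ball 0 1, W z := setIntegral_nonneg measurableSet_ball hW0
  have hκ := logLaplacianMass_pos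
  refine ⟨logLaplacianMass⁻¹ * (Λ * M * (2 * ∫ z in Metric.ball 0 ρ, V z) +
    Λ * ∫ z in Metric.ball 0 1, W z), by positivity, fun f D hf h0 hD hfV F hF => ?_⟩
  have hne : f 0 ≠ 0 := norm_ne_zero_iff.1 (by simp [h0])
  have hUi : IntegrableOn (fun z => Real.log ‖f z‖) (Metric.ball 0 ρ) :=
    (integrableOn_log_norm hf hne (isCompact_closedBall 0 ρ) hKρ).mono_set
      Metric.ball_subset_closedBall
  have hU0 := integral_ball_log_norm_nonneg hf h0 hρ1
  have key (δ : ℝ) (hδ : 0 < δ) :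
      ∑ c ∈ F, analyticOrderNatAt f c * weightTest s δ G c ≤
      logLaplacianMass⁻¹ * (Λ * M * (2 * ∫ z in Metric.ball 0 ρ, V z) +
        Λ * ∫ z in Metric.ball 0 1, W z) * D := by
    have ht := isTestFunction_weightTest (s := s) hδ hG
    have hK := isCompact_closedBall (0 : ℂ) √(1 - δ)
    have hKb : Metric.closedBall (0 : ℂ) √(1 - δ) ⊆ Metric.ball 0 1 :=
      Metric.closedBall_subset_ball (by rw [Real.sqrt_lt' one_pos]; linarith)
    obtain ⟨Z, hZ, hint⟩ := ht.exists_integral_log_norm_mul hK hKb hf hne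
    have hpos : ∀ c ∈ Metric.ball (0 : ℂ) 1, 0 ≤ weightTest s δ G c := fun c hc =>
      mul_nonneg (cutPow_nonneg (one_sub_norm_sq_pos hc).le) (sq_nonneg _)
    have hsum : ∑ c ∈ F, analyticOrderNatAt f c * weightTest s δ G c ≤
        ∑ c ∈ Z, analyticOrderNatAt f c * weightTest s δ G c := by
      classical
      -- Points of `F` outside the support of the weight contribute `0`; the others are among the
      -- zeros in `Z`.
      rw [← Finset.sum_filter_of_ne (p := fun c => c ∈ Metric.closedBall (0 : ℂ) √(1 - δ))]
      · refine Finset.sum_le_sum_of_subset_of_nonneg (fun c hc => ?_) fun c hc _ => ?_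
        · obtain ⟨h1, h2⟩ := Finset.mem_filter.1 hc
          exact (hZ c).2 ⟨h2, (hF c h1).2⟩
        · exact mul_nonneg (Nat.cast_nonneg _) (hpos c (hKb ((hZ c).1 hc).1))
      · intro c _ hc
        by_contra h
        exact hc (by rw [ht.eq_zero c h, mul_zero])
    set lap : ℂ → ℝ := fun z => weightTest₂ s δ G 1 z + weightTest₂ s δ G Complex.I z
    have hlap : ∀ z ∈ Metric.ball (0 : ℂ) 1,
        |lap z| ≤ Λ * (‖G z‖ ^ 2 * (1 - ‖z‖ ^ 2) ^ (s - 2)) := fun z hz =>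
      abs_laplacian_weightTest_le hs hδ hz (hℓ z hz) (hB z hz)
    have hlap0 : ∀ z ∈ Metric.ball (0 : ℂ) 1, ρ ≤ ‖z‖ → 0 ≤ lap z := fun z hz hρz =>
      laplacian_weightTest_nonneg hs hδ hz (hℓ z hz) (hA z hz)
        (hρ _ hρz (mem_ball_zero_iff.1 hz))
    have hlapz : ∀ z ∉ Metric.ball (0 : ℂ) 1, lap z = 0 := fun z hz => by
      have : z ∉ Metric.closedBall (0 : ℂ) √(1 - δ) := fun h => hz (hKb h)
      simp [lap, ht.dd_eq_zero _ z this]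
    have i1 : Integrable ((Metric.ball (0 : ℂ) ρ).indicator fun z =>
        Λ * M * (2 * D * V z - Real.log ‖f z‖)) :=
      (integrable_indicator_iff measurableSet_ball).2 (((hVi.const_mul _).sub hUi).const_mul _)
    have i2 : Integrable ((Metric.ball (0 : ℂ) 1).indicator fun z => Λ * D * W z) :=
      (integrable_indicator_iff measurableSet_ball).2 (hW.const_mul _)
    have hle : ∫ z, Real.log ‖f z‖ * lap z ≤ ∫ z, ((Metric.ball (0 : ℂ) ρ).indicator (fun z =>
        Λ * M * (2 * D * V z - Real.log ‖f z‖)) z +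
        (Metric.ball (0 : ℂ) 1).indicator (fun z => Λ * D * W z) z) := by
      have iU := integrableOn_log_norm hf hne hK hKb
      refine integral_mono ?_ (i1.add i2) fun z => ?_
      · simp only [lap, mul_add]
        exact (ht.integrable_mul_dd hK iU 1).add (ht.integrable_mul_dd hK iU Complex.I)
      · dsimp only
        by_cases hz : z ∈ Metric.ball (0 : ℂ) 1
        · have hDV : 0 ≤ D * V z := mul_nonneg hD (hV0 z hz)
          rw [Set.indicator_of_mem hz]
          by_cases hzρ : z ∈ Metric.ball (0 : ℂ) ρ
          · rw [Set.indicator_of_mem hzρ]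
            have h1 : |lap z| ≤ Λ * M := (hlap z hz).trans (mul_le_mul_of_nonneg_left
              ((le_abs_self _).trans (hM z (Metric.ball_subset_closedBall hzρ))) hΛ)
            -- Follows from `log ‖f z‖ ≤ D * V z` and `0 ≤ D * V z`. The right side carries `log ‖f
            -- z‖` without absolute value, so its integral is controlled by the area mean.
            have h2 : |Real.log ‖f z‖| ≤ 2 * D * V z - Real.log ‖f z‖ := by
              have := hfV z hz
              rw [abs_le]; constructor <;> linarith
            have h3 : 0 ≤ Λ * D * W z := mul_nonneg (mul_nonneg hΛ hD) (hW0 z hz)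
            calc Real.log ‖f z‖ * lap z ≤ |Real.log ‖f z‖| * |lap z| := by
                  rw [← abs_mul]; exact le_abs_self _
              _ ≤ (2 * D * V z - Real.log ‖f z‖) * (Λ * M) := by
                  gcongr
                  exact (abs_nonneg _).trans h2
              _ ≤ _ := by linarith
          · rw [Set.indicator_of_notMem hzρ, zero_add]
            rw [mem_ball_zero_iff, not_lt] at hzρ
            have h1 := hlap0 z hz hzρ
            calc Real.log ‖f z‖ * lap z ≤ D * V z * lap z :=
                  mul_le_mul_of_nonneg_right (hfV z hz) h1
              _ ≤ D * V z * (Λ * (‖G z‖ ^ 2 * (1 - ‖z‖ ^ 2) ^ (s - 2))) :=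
                  mul_le_mul_of_nonneg_left ((le_abs_self _).trans (hlap z hz)) hDV
              _ = Λ * D * W z := by simp only [W]; ring
        · rw [hlapz z hz, Set.indicator_of_notMem hz,
            Set.indicator_of_notMem fun h => hz (hbρ h)]
          simp
    rw [integral_add i1 i2, integral_indicator measurableSet_ball,
      integral_indicator measurableSet_ball, integral_const_mul, integral_const_mul,
      integral_sub (hVi.const_mul _) hUi, integral_const_mul] at hle
    have hΛM : 0 ≤ Λ * M := mul_nonneg hΛ hM0
    refine hsum.trans ?_
    rw [mul_assoc, inv_mul_eq_div, le_div_iff₀ hκ, mul_comm, ← hint]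
    refine hle.trans ?_
    -- The term `-Λ * M * ∫ log ‖f‖` over the inner disc is nonpositive by `hU0` and is dropped.
    nlinarith [mul_nonneg hΛM hU0]
  have hlim : Tendsto (fun δ : ℝ => ∑ c ∈ F, (analyticOrderNatAt f c : ℝ) * weightTest s δ G c)
      (𝓝[>] 0) (𝓝 (∑ c ∈ F, analyticOrderNatAt f c * ((1 - ‖c‖ ^ 2) ^ s * ‖G c‖ ^ 2))) := by
    refine tendsto_nhdsWithin_of_tendsto_nhds (tendsto_finsetSum _ fun c hc => ?_)
    refine Tendsto.const_mul _ (Tendsto.mul_const _ ?_)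
    have hv := one_sub_norm_sq_pos (hF c hc).1
    have hcont : Continuous fun δ => cutPow s δ (1 - ‖c‖ ^ 2) := by unfold cutPow; fun_prop
    have := hcont.tendsto 0
    have e : cutPow s 0 (1 - ‖c‖ ^ 2) = (1 - ‖c‖ ^ 2) ^ s := by
      rw [cutPow, sub_zero, max_eq_left hv.le, ← Real.rpow_natCast (1 - ‖c‖ ^ 2) 3, ← Real.rpow_add hv]
      congr 1; push_cast; ring
    rwa [e] at this
  refine le_of_tendsto hlim ?_
  filter_upwards [self_mem_nhdsWithin] with δ hδ
  exact key δ hδ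

/-! ### Integrability of the majorant -/

lemma abs_div_pi_le_norm_circleMap_sub_one {r θ : ℝ} (hr : 0 ≤ r) (hθ : |θ| ≤ Real.pi) :
    |θ| / Real.pi ≤ ‖circleMap 0 r θ - 1‖ := by
  have hπ := Real.pi_pos
  have hcos := Real.cos_le_one_sub_mul_cos_sq hθ
  have hn : ‖circleMap 0 r θ - 1‖ ^ 2 = (1 - r) ^ 2 + 2 * r * (1 - Real.cos θ) := by
    rw [← polarCoord_symm_eq_circleMap (r, θ), Complex.polarCoord_symm_apply,
      ← Complex.normSq_eq_norm_sq, Complex.normSq_apply]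
    simp [-Complex.ofReal_cos, -Complex.ofReal_sin]
    linear_combination r ^ 2 * Real.sin_sq_add_cos_sq θ
  refine (sq_le_sq₀ (by positivity) (norm_nonneg _)).1 ?_
  rw [hn]
  set y := (|θ| / Real.pi) ^ 2
  have hy : 2 / Real.pi ^ 2 * θ ^ 2 = 2 * y := by
    simp only [y, div_pow, sq_abs]; ring
  have hy0 : 0 ≤ y := sq_nonneg _
  have hy1 : y ≤ 1 := pow_le_one₀ (by positivity) ((div_le_one hπ).2 hθ)
  have h1 : 2 * y ≤ 1 - Real.cos θ := by linarith
  have h2 : 2 * r * (2 * y) ≤ 2 * r * (1 - Real.cos θ) := by gcongr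
  -- The difference to be shown nonnegative is at least `(1 - r)² + 4 r y - y = (1 - r)² (1 - y) + y
  -- (r² + 2 r)`.
  nlinarith [mul_nonneg hr hy0, mul_nonneg (sq_nonneg (1 - r)) (sub_nonneg.2 hy1),
    mul_nonneg (sq_nonneg r) hy0]

lemma integrable_abs_rpow_indicator {η R : ℝ} (hη : 0 < η) (hR : 0 ≤ R) :
    IntegrableOn (fun θ : ℝ => |θ| ^ (η - 1)) (Set.Ioo (-R) R) := by
  have h : Integrable fun x : ℝ => (Set.Iio R).indicator (fun y => y ^ (η - 1)) ‖x‖ := by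
    rw [integrable_fun_norm_addHaar volume (f := (Set.Iio R).indicator fun y => y ^ (η - 1))]
    simp only [Module.finrank_self, Nat.sub_self, pow_zero, one_smul]
    rw [integrableOn_indicator_iff measurableSet_Iio, Set.inter_comm, Set.Ioi_inter_Iio,
      ← intervalIntegrable_iff_integrableOn_Ioo_of_le hR]
    exact intervalIntegral.intervalIntegrable_rpow' (by linarith)
  refine h.integrableOn.congr_fun (fun x hx => ?_) measurableSet_Ioo
  have : ‖x‖ ∈ Set.Iio R := abs_lt.2 hx
  exact Set.indicator_of_mem this _

lemma integrableOn_one_sub_rpow {η : ℝ} (hη : 0 < η) :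
    IntegrableOn (fun r : ℝ => (1 - r) ^ (η - 1)) (Set.Ioo 0 1) := by
  rw [← intervalIntegrable_iff_integrableOn_Ioo_of_le zero_le_one]
  have := (intervalIntegral.intervalIntegrable_rpow' (a := 0) (b := 1)
    (r := η - 1) (by linarith)).comp_sub_left 1
  simpa using this.symm

/-- Since `η - 1 < 0`, the bound `‖z - 1‖ ≥ |θ| / π` dominates the integrand by a product of a
function of `r` and a function of `θ`, each integrable. -/
lemma integrableOn_rpow_mul_norm_sub_one_rpow {η : ℝ} (hη : 0 < η) (hη1 : η < 1) :
    IntegrableOn (fun z : ℂ => (1 - ‖z‖) ^ (η - 1) * ‖z - 1‖ ^ (η - 1)) (Metric.ball 0 1) := by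
  rw [← integrable_indicator_iff measurableSet_ball]
  have hm : Measurable ((Metric.ball (0 : ℂ) 1).indicator
      fun z : ℂ => (1 - ‖z‖) ^ (η - 1) * ‖z - 1‖ ^ (η - 1)) :=
    Measurable.indicator (by fun_prop) measurableSet_ball
  rw [integrable_iff_integrableOn_polarCoord hm]
  have h1 : Integrable ((Set.Ioo (0 : ℝ) 1).indicator fun r => (1 - r) ^ (η - 1))
      (volume.restrict (Set.Ioi 0)) :=
    ((integrable_indicator_iff measurableSet_Ioo).2 (integrableOn_one_sub_rpow hη)).integrableOn
  have h2 := (integrable_abs_rpow_indicator hη Real.pi_pos.le).div_const (Real.pi ^ (η - 1))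
  have h3 := h1.mul_prod h2
  rw [Measure.prod_restrict, ← Measure.volume_eq_prod] at h3
  refine Integrable.mono' h3 ?_ ?_
  · have hc : Measurable fun p : ℝ × ℝ => circleMap 0 p.1 p.2 := by
      simp only [← polarCoord_symm_eq_circleMap]
      exact continuous_complexPolarCoord_symm.measurable
    exact (measurable_fst.mul (hm.comp hc)).aestronglyMeasurable
  · filter_upwards [ae_restrict_mem (measurableSet_Ioi.prod measurableSet_Ioo),
      ae_restrict_of_ae (s := Set.Ioi (0 : ℝ) ×ˢ Set.Ioo (-Real.pi) Real.pi)
        (show ∀ᵐ p : ℝ × ℝ, p.2 ≠ 0 from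
          Measure.quasiMeasurePreserving_snd.ae
            (p := fun θ : ℝ => θ ≠ 0) (by simp [ae_iff]))] with p hp hp0
    have hr : 0 < p.1 := hp.1
    have hθ : |p.2| < Real.pi := abs_lt.2 hp.2
    by_cases hr1 : p.1 < 1
    · have hmem : circleMap 0 p.1 p.2 ∈ Metric.ball (0 : ℂ) 1 := by
        simpa [abs_of_pos hr] using hr1
      rw [Set.indicator_of_mem hmem, Set.indicator_of_mem (Set.mem_Ioo.2 ⟨hr, hr1⟩),
        norm_circleMap_zero, abs_of_pos hr, ← Real.div_rpow (abs_nonneg _) Real.pi_pos.le]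
      have e1 : ‖circleMap 0 p.1 p.2 - 1‖ ^ (η - 1) ≤ (|p.2| / Real.pi) ^ (η - 1) :=
        Real.rpow_le_rpow_of_nonpos (by have := Real.pi_pos; positivity)
          (abs_div_pi_le_norm_circleMap_sub_one hr.le hθ.le) (by linarith)
      have e2 : 0 ≤ (1 - p.1) ^ (η - 1) := Real.rpow_nonneg (by linarith) _
      rw [Real.norm_of_nonneg (by positivity)]
      calc _ ≤ 1 * ((1 - p.1) ^ (η - 1) * (|p.2| / Real.pi) ^ (η - 1)) := by gcongr
        _ = _ := one_mul _
    · have hmem : circleMap 0 p.1 p.2 ∉ Metric.ball (0 : ℂ) 1 := by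
        simpa [abs_of_pos hr] using hr1
      have : p.1 ∉ Set.Ioo (0 : ℝ) 1 := fun h => hr1 h.2
      simp [Set.indicator_of_notMem hmem, Set.indicator_of_notMem this]

lemma integrableOn_rpow_mul_norm_sub_rpow {η : ℝ} (hη : 0 < η) (hη1 : η < 1) {ζ : ℂ}
    (hζ : ‖ζ‖ = 1) :
    IntegrableOn (fun z : ℂ => (1 - ‖z‖) ^ (η - 1) * ‖z - ζ‖ ^ (η - 1)) (Metric.ball 0 1) := by
  have hζ0 : ζ ≠ 0 := norm_ne_zero_iff.1 (by simp [hζ])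
  have h := (integrable_indicator_iff measurableSet_ball).2
    (integrableOn_rpow_mul_norm_sub_one_rpow hη hη1)
  rw [← integrable_indicator_iff measurableSet_ball]
  let u : Circle := ⟨ζ⁻¹, mem_sphere_zero_iff_norm.2 (by simp [hζ])⟩
  have h2 := ((rotation u).measurePreserving.integrable_comp_emb
    (rotation u).toHomeomorph.measurableEmbedding).2 h
  refine h2.congr (Eventually.of_forall fun z => ?_)
  have e0 : rotation u z = ζ⁻¹ * z := rotation_apply u z
  have e1 : ‖ζ⁻¹ * z‖ = ‖z‖ := by simp [hζ]
  have e2 : ‖ζ⁻¹ * z - 1‖ = ‖z - ζ‖ := by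
    rw [show ζ⁻¹ * z - 1 = ζ⁻¹ * (z - ζ) by field_simp, norm_mul, norm_inv, hζ]; simp
  simp only [Function.comp, Set.indicator, e0, mem_ball_zero_iff, e1, e2]

/-! ### The weight attached to a finite subset of the circle -/

/-- The holomorphic function `∏ (1 - z / ζ) ^ b` over `ζ ∈ E`. -/
noncomputable def circleWeight (E : Finset ℂ) (b : ℝ) (z : ℂ) : ℂ :=
  Complex.exp (∑ ζ ∈ E, b * Complex.log (1 - z / ζ))

/-- The logarithmic derivative of `circleWeight`. -/
noncomputable def circleWeightLogDeriv (E : Finset ℂ) (b : ℝ) (z : ℂ) : ℂ :=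
  -∑ ζ ∈ E, b * (ζ - z)⁻¹

section weight

variable {E : Finset ℂ} {b : ℝ} {z ζ : ℂ}

lemma one_sub_div_mem_slitPlane (hζ : ‖ζ‖ = 1) (hz : z ∈ Metric.ball (0 : ℂ) 1) :
    1 - z / ζ ∈ Complex.slitPlane := by
  left
  have : ‖z / ζ‖ < 1 := by simpa [hζ] using hz
  have := (Complex.abs_re_le_norm (z / ζ)).trans_lt this
  rw [Complex.sub_re, Complex.one_re]
  linarith [(abs_lt.1 this).2]

lemma norm_one_sub_div (hζ : ‖ζ‖ = 1) : ‖1 - z / ζ‖ = ‖z - ζ‖ := by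
  have hζ0 : ζ ≠ 0 := norm_ne_zero_iff.1 (by simp [hζ])
  rw [show 1 - z / ζ = (ζ - z) / ζ by field_simp, norm_div, hζ, div_one, norm_sub_rev]

lemma norm_sub_pos_of_mem_ball (hζ : ‖ζ‖ = 1) (hz : z ∈ Metric.ball (0 : ℂ) 1) :
    0 < ‖z - ζ‖ := by
  rw [mem_ball_zero_iff] at hz
  refine norm_pos_iff.2 (sub_ne_zero.2 ?_)
  rintro rfl
  exact hz.ne hζ

lemma analyticOnNhd_circleWeight (hE : ∀ ζ ∈ E, ‖ζ‖ = 1) :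
    AnalyticOnNhd ℂ (circleWeight E b) (Metric.ball 0 1) := fun z hz => by
  unfold circleWeight
  refine AnalyticAt.cexp (Finset.analyticAt_fun_sum _ fun ζ hζ => ?_)
  refine analyticAt_const.mul (AnalyticAt.clog (by fun_prop)
    (one_sub_div_mem_slitPlane (hE ζ hζ) hz))

lemma deriv_circleWeight (hE : ∀ ζ ∈ E, ‖ζ‖ = 1) (hz : z ∈ Metric.ball (0 : ℂ) 1) :
    deriv (circleWeight E b) z = circleWeightLogDeriv E b z * circleWeight E b z := by
  have h : ∀ ζ ∈ E, HasDerivAt (fun z => (b : ℂ) * Complex.log (1 - z / ζ))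
      (-(b * (ζ - z)⁻¹)) z := fun ζ hζ => by
    have hζ0 : ζ ≠ 0 := norm_ne_zero_iff.1 (by simp [hE ζ hζ])
    have hs := one_sub_div_mem_slitPlane (hE ζ hζ) hz
    have hne : ζ - z ≠ 0 := by
      rw [← norm_ne_zero_iff, norm_sub_rev]
      exact (norm_sub_pos_of_mem_ball (hE ζ hζ) hz).ne'
    refine ((((hasDerivAt_id z).div_const ζ).const_sub 1).clog hs |>.const_mul (b : ℂ)).congr_deriv
      ?_
    simp only [id]
    rw [show 1 - z / ζ = (ζ - z) / ζ by field_simp]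
    field_simp
  have := (HasDerivAt.fun_sum h).cexp
  unfold circleWeight circleWeightLogDeriv
  rw [this.deriv, mul_comm, Finset.sum_neg_distrib]

/-- The map `z ↦ z / (ζ - z)` sends the disc into the half-plane `Re > -1/2`, so each summand is at
most `b / 2` although its modulus is unbounded near `ζ`. -/
lemma re_mul_circleWeightLogDeriv_le (hb : 0 ≤ b) (hE : ∀ ζ ∈ E, ‖ζ‖ = 1)
    (hz : z ∈ Metric.ball (0 : ℂ) 1) :
    (z * circleWeightLogDeriv E b z).re ≤ E.card * (b / 2) := by
  rw [circleWeightLogDeriv, mul_neg, Finset.mul_sum, Complex.neg_re, Complex.re_sum,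
    ← Finset.sum_neg_distrib, ← nsmul_eq_mul]
  refine Finset.sum_le_card_nsmul _ _ _ fun ζ hζ => ?_
  have hp := norm_sub_pos_of_mem_ball (hE ζ hζ) hz
  have h1 : -(z * (ζ - z)⁻¹).re ≤ 1 / 2 := by
    have h2 : ‖ζ‖ ^ 2 = 1 := by rw [hE ζ hζ, one_pow]
    have h3 : ‖z‖ ^ 2 ≤ 1 := by linarith [one_sub_norm_sq_pos hz]
    rw [norm_sub_rev] at hp
    have h4 : 0 < Complex.normSq (ζ - z) := by rw [Complex.normSq_eq_norm_sq]; positivity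
    rw [← Complex.normSq_eq_norm_sq, Complex.normSq_apply] at h2 h3
    rw [Complex.mul_re, Complex.inv_re, Complex.inv_im]
    have h5 : -(z.re * ((ζ - z).re / Complex.normSq (ζ - z)) -
        z.im * (-(ζ - z).im / Complex.normSq (ζ - z))) =
        -(z.re * (ζ - z).re + z.im * (ζ - z).im) / Complex.normSq (ζ - z) := by ring
    rw [h5, div_le_iff₀ h4, Complex.normSq_apply, Complex.sub_re, Complex.sub_im]
    nlinarith
  have h6 : (z * (b * (ζ - z)⁻¹)).re = b * (z * (ζ - z)⁻¹).re := by
    rw [mul_left_comm, Complex.re_ofReal_mul]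
  rw [h6]
  nlinarith

lemma norm_circleWeightLogDeriv_mul_le (hb : 0 ≤ b) (hE : ∀ ζ ∈ E, ‖ζ‖ = 1)
    (hz : z ∈ Metric.ball (0 : ℂ) 1) :
    ‖circleWeightLogDeriv E b z‖ * (1 - ‖z‖ ^ 2) ≤ E.card * (2 * b) := by
  have hv := one_sub_norm_sq_pos hz
  rw [circleWeightLogDeriv, norm_neg]
  refine (mul_le_mul_of_nonneg_right (norm_sum_le _ _) hv.le).trans ?_
  rw [Finset.sum_mul, ← nsmul_eq_mul]
  refine Finset.sum_le_card_nsmul _ _ _ fun ζ hζ => ?_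
  have hp := norm_sub_pos_of_mem_ball (hE ζ hζ) hz
  have h1 : 1 - ‖z‖ ≤ ‖z - ζ‖ := by
    rw [← hE ζ hζ, norm_sub_rev]; exact norm_sub_norm_le ζ z
  have h2 : 1 - ‖z‖ ^ 2 ≤ 2 * ‖z - ζ‖ := by
    have := mem_ball_zero_iff.1 hz
    nlinarith [norm_nonneg z]
  rw [norm_mul, norm_inv, norm_sub_rev, Complex.norm_real, Real.norm_of_nonneg hb, mul_assoc,
    inv_mul_eq_div]
  rw [show 2 * b = b * 2 by ring]
  gcongr
  rwa [div_le_iff₀ hp]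

lemma norm_circleWeight_sq (hE : ∀ ζ ∈ E, ‖ζ‖ = 1) (hz : z ∈ Metric.ball (0 : ℂ) 1) :
    ‖circleWeight E b z‖ ^ 2 = ∏ ζ ∈ E, ‖z - ζ‖ ^ (2 * b) := by
  rw [circleWeight, Complex.norm_exp, Complex.re_sum, ← Real.exp_nat_mul, Finset.mul_sum,
    Real.exp_sum]
  refine Finset.prod_congr rfl fun ζ hζ => ?_
  rw [Complex.re_ofReal_mul, Complex.log_re, norm_one_sub_div (hE ζ hζ),
    Real.rpow_def_of_pos (norm_sub_pos_of_mem_ball (hE ζ hζ) hz)]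
  congr 1
  push_cast
  ring

lemma exists_pos_le_dist (E : Finset ℂ) :
    ∃ d : ℝ, 0 < d ∧ ∀ ζ ∈ E, ∀ ξ ∈ E, ζ ≠ ξ → 2 * d ≤ dist ζ ξ := by
  classical
  rcases E.offDiag.eq_empty_or_nonempty with h | h
  · refine ⟨1, one_pos, fun ζ hζ ξ hξ hne => ?_⟩
    have : (ζ, ξ) ∈ E.offDiag := Finset.mem_offDiag.2 ⟨hζ, hξ, hne⟩
    simp [h] at this
  · obtain ⟨p, hp, hmin⟩ := E.offDiag.exists_min_image (fun p => dist p.1 p.2) h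
    have hp' := Finset.mem_offDiag.1 hp
    have hd := dist_pos.2 hp'.2.2
    refine ⟨dist p.1 p.2 / 2, by linarith, fun ζ hζ ξ hξ hne => ?_⟩
    have h1 := hmin (ζ, ξ) (Finset.mem_offDiag.2 ⟨hζ, hξ, hne⟩)
    simp only at h1
    linarith

lemma exists_mem_infDist_eq (hne : E.Nonempty) (z : ℂ) :
    ∃ ζ ∈ E, Metric.infDist z E = ‖z - ζ‖ := by
  obtain ⟨ζ, hζ, h⟩ := E.finite_toSet.isCompact.exists_infDist_eq_dist hne z
  exact ⟨ζ, hζ, by rw [h, dist_eq_norm]⟩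

/-- On the disc, `|circleWeight|²` is comparable to a power of the distance to `E`. -/
lemma exists_circleWeight_bounds (hne : E.Nonempty) (hE : ∀ ζ ∈ E, ‖ζ‖ = 1) (hb : 0 ≤ b) :
    ∃ c₁ c₂ : ℝ, 0 < c₁ ∧ 0 < c₂ ∧ ∀ z ∈ Metric.ball (0 : ℂ) 1,
      c₁ * Metric.infDist z E ^ (2 * b) ≤ ‖circleWeight E b z‖ ^ 2 ∧
      ‖circleWeight E b z‖ ^ 2 ≤ c₂ * Metric.infDist z E ^ (2 * b) := by
  classical
  obtain ⟨d, hd, hsep⟩ := exists_pos_le_dist E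
  -- The nearest point `ξ` supplies the distance. Every other factor lies between `d` and `2`,
  -- because `2 d ≤ ‖z - ζ‖ + ‖z - ξ‖ ≤ 2 ‖z - ζ‖`.
  refine ⟨(d ^ (2 * b)) ^ (E.card - 1), (2 ^ (2 * b)) ^ (E.card - 1), by positivity,
    by positivity, fun z hz => ?_⟩
  obtain ⟨ξ, hξ, hdist⟩ := exists_mem_infDist_eq hne z
  rw [norm_circleWeight_sq hE hz, ← Finset.prod_erase_mul E _ hξ, hdist,
    ← Finset.card_erase_of_mem hξ, ← Finset.prod_const, ← Finset.prod_const]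
  constructor
  · gcongr with ζ hζ
    have hζE := Finset.mem_of_mem_erase hζ
    have h1 := hsep ζ hζE ξ hξ (Finset.ne_of_mem_erase hζ)
    have h2 : ‖z - ξ‖ ≤ ‖z - ζ‖ := by
      rw [← hdist, ← dist_eq_norm]; exact Metric.infDist_le_dist_of_mem hζE
    have h3 := dist_triangle_left ζ ξ z
    rw [dist_eq_norm z, dist_eq_norm z] at h3
    linarith
  · gcongr with ζ hζ
    refine (norm_sub_le _ _).trans ?_
    rw [hE ζ (Finset.mem_of_mem_erase hζ)]
    linarith [mem_ball_zero_iff.1 hz]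

end weight

lemma infDist_pos_of_mem_ball {E : Finset ℂ} (hne : E.Nonempty) (hE : ∀ ζ ∈ E, ‖ζ‖ = 1) {z : ℂ}
    (hz : z ∈ Metric.ball (0 : ℂ) 1) : 0 < Metric.infDist z E := by
  obtain ⟨ζ, hζ, h⟩ := exists_mem_infDist_eq hne z
  rw [h]
  exact norm_sub_pos_of_mem_ball (hE ζ hζ) hz

lemma infDist_le_two {E : Finset ℂ} (hne : E.Nonempty) (hE : ∀ ζ ∈ E, ‖ζ‖ = 1) {z : ℂ}
    (hz : z ∈ Metric.ball (0 : ℂ) 1) : Metric.infDist z E ≤ 2 := by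
  obtain ⟨ζ, hζ, h⟩ := exists_mem_infDist_eq hne z
  rw [h]
  refine (norm_sub_le _ _).trans ?_
  rw [hE ζ hζ]
  linarith [mem_ball_zero_iff.1 hz]

/-- The minimum is attained, so its power is one of the summands, whatever the sign of `t`. This
reduces the singularity along `E` to single points. -/
lemma infDist_rpow_le_sum {E : Finset ℂ} (hne : E.Nonempty) (z : ℂ) (t : ℝ) :
    Metric.infDist z E ^ t ≤ ∑ ζ ∈ E, ‖z - ζ‖ ^ t := by
  obtain ⟨ζ, hζ, h⟩ := exists_mem_infDist_eq hne z
  rw [h]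
  exact Finset.single_le_sum (f := fun ζ => ‖z - ζ‖ ^ t)
    (fun ξ _ => Real.rpow_nonneg (norm_nonneg _) _) hζ

lemma one_sub_norm_sq_rpow_le {z : ℂ} (hz : z ∈ Metric.ball (0 : ℂ) 1) (t : ℝ) :
    (1 - ‖z‖ ^ 2) ^ t ≤ 2 ^ |t| * (1 - ‖z‖) ^ t := by
  rw [mem_ball_zero_iff] at hz
  have h0 := norm_nonneg z
  rw [show 1 - ‖z‖ ^ 2 = (1 + ‖z‖) * (1 - ‖z‖) by ring,
    Real.mul_rpow (by linarith) (by linarith)]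
  refine mul_le_mul_of_nonneg_right ?_ (Real.rpow_nonneg (by linarith) _)
  calc (1 + ‖z‖) ^ t ≤ (1 + ‖z‖) ^ |t| :=
        Real.rpow_le_rpow_of_exponent_le (by linarith) (le_abs_self t)
    _ ≤ 2 ^ |t| := Real.rpow_le_rpow (by linarith) (by linarith) (abs_nonneg t)

lemma rpow_le_const_mul_rpow {x M a b : ℝ} (hx : 0 < x) (hxM : x ≤ M) (hab : a ≤ b) :
    x ^ b ≤ M ^ (b - a) * x ^ a := by
  rw [show x ^ b = x ^ (b - a) * x ^ a by rw [← Real.rpow_add hx]; congr 1; ring]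
  gcongr

section majorant

variable {E : Finset ℂ} {p q : ℝ}

lemma continuousOn_majorant (hne : E.Nonempty) (hE : ∀ ζ ∈ E, ‖ζ‖ = 1) :
    ContinuousOn (fun z : ℂ => ((1 - ‖z‖) ^ p * Metric.infDist z E ^ q)⁻¹)
      (Metric.ball 0 1) := by
  have hd : Continuous fun z : ℂ => Metric.infDist z (E : Set ℂ) := Metric.continuous_infDist_pt _
  refine ContinuousOn.inv₀ (ContinuousOn.mul (ContinuousOn.rpow_const (by fun_prop)
    fun z hz => Or.inl ?_) (ContinuousOn.rpow_const hd.continuousOn fun z hz => Or.inl ?_))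
    fun z hz => ?_
  · linarith [mem_ball_zero_iff.1 hz]
  · exact (infDist_pos_of_mem_ball hne hE hz).ne'
  · have h1 : 0 < 1 - ‖z‖ := by linarith [mem_ball_zero_iff.1 hz]
    have h2 := infDist_pos_of_mem_ball hne hE hz
    positivity

lemma integrableOn_majorant_mul_weight (hne : E.Nonempty) (hE : ∀ ζ ∈ E, ‖ζ‖ = 1) {ε a : ℝ}
    (hε : 0 < ε) (ha : 0 ≤ a) (haq : q - 1 + ε ≤ a) :
    IntegrableOn (fun z => ((1 - ‖z‖) ^ p * Metric.infDist z E ^ q)⁻¹ *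
      (‖circleWeight E (a / 2) z‖ ^ 2 * (1 - ‖z‖ ^ 2) ^ (p + 1 + ε - 2))) (Metric.ball 0 1) := by
  obtain ⟨c₁, c₂, -, hc₂, hw⟩ := exists_circleWeight_bounds hne hE (b := a / 2) (by positivity)
  rw [mul_div_cancel₀ a two_ne_zero] at hw
  -- Lowering `ε` keeps `η - 1` negative, as the one-point integrals require; the exponents `ε - 1`
  -- and `a - q` are both at least `η - 1`.
  set η := min ε (1 / 2)
  have hη : 0 < η := lt_min hε (by norm_num)
  have hη1 : η < 1 := (min_le_right _ _).trans_lt (by norm_num)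
  have hηε : η ≤ ε := min_le_left _ _
  set T := c₂ * 2 ^ |p + 1 + ε - 2| * 2 ^ (a - q - (η - 1))
  have hi : IntegrableOn (fun z : ℂ => T * ∑ ζ ∈ E, (1 - ‖z‖) ^ (η - 1) * ‖z - ζ‖ ^ (η - 1))
      (Metric.ball 0 1) :=
    (integrable_finsetSum _ fun ζ hζ =>
      integrableOn_rpow_mul_norm_sub_rpow hη hη1 (hE ζ hζ)).const_mul _
  refine Integrable.mono' hi (ContinuousOn.aestronglyMeasurable ?_ measurableSet_ball) ?_
  · refine (continuousOn_majorant hne hE).mul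
      (((analyticOnNhd_circleWeight hE).continuousOn.norm.pow 2).mul
        (ContinuousOn.rpow_const (by fun_prop) fun z hz => ?_))
    exact Or.inl (one_sub_norm_sq_pos hz).ne'
  · filter_upwards [ae_restrict_mem measurableSet_ball] with z hz
    have h1 : 0 < 1 - ‖z‖ := by linarith [mem_ball_zero_iff.1 hz]
    have h1' : 1 - ‖z‖ ≤ 1 := by linarith [norm_nonneg z]
    have h2 := infDist_pos_of_mem_ball hne hE hz
    have h3 := infDist_le_two hne hE hz
    have h4 := infDist_rpow_le_sum hne z (η - 1)
    have h5 := one_sub_norm_sq_rpow_le hz (p + 1 + ε - 2)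
    have h6 := (hw z hz).2
    have h7 := one_sub_norm_sq_pos hz
    rw [Real.norm_of_nonneg (by positivity)]
    set d := Metric.infDist z E
    have e1 : ((1 - ‖z‖) ^ p)⁻¹ * (1 - ‖z‖) ^ (p + 1 + ε - 2) = (1 - ‖z‖) ^ (ε - 1) := by
      rw [← Real.rpow_neg h1.le, ← Real.rpow_add h1]; congr 1; ring
    have e2 : (d ^ q)⁻¹ * d ^ a = d ^ (a - q) := by
      rw [← Real.rpow_neg h2.le, ← Real.rpow_add h2]; congr 1; ring
    have b1 := rpow_le_const_mul_rpow h1 h1' (show η - 1 ≤ ε - 1 by linarith)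
    rw [Real.one_rpow, one_mul] at b1
    have b2 := rpow_le_const_mul_rpow h2 h3 (show η - 1 ≤ a - q by linarith)
    calc _ ≤ ((1 - ‖z‖) ^ p * d ^ q)⁻¹ *
          (c₂ * d ^ a * (2 ^ |p + 1 + ε - 2| * (1 - ‖z‖) ^ (p + 1 + ε - 2))) := by gcongr
      _ = c₂ * 2 ^ |p + 1 + ε - 2| * ((((1 - ‖z‖) ^ p)⁻¹ * (1 - ‖z‖) ^ (p + 1 + ε - 2)) *
          ((d ^ q)⁻¹ * d ^ a)) := by rw [mul_inv]; ring
      _ = c₂ * 2 ^ |p + 1 + ε - 2| * ((1 - ‖z‖) ^ (ε - 1) * d ^ (a - q)) := by rw [e1, e2]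
      _ ≤ c₂ * 2 ^ |p + 1 + ε - 2| * ((1 - ‖z‖) ^ (η - 1) * (2 ^ (a - q - (η - 1)) *
          ∑ ζ ∈ E, ‖z - ζ‖ ^ (η - 1))) := by
          gcongr
          exact b2.trans (by gcongr)
      _ = _ := by rw [← Finset.mul_sum]; simp only [T]; ring

end majorant

/-! ### The theorem for a finite set `E` -/

theorem theorem2 (E : Set ℂ) (hEfin : E.Finite) (hEne : E.Nonempty)
    (hE : E ⊆ Metric.sphere (0 : ℂ) 1)
    (p q ε : ℝ) (hp : 0 ≤ p) (hq : 0 ≤ q) (hε : 0 < ε) :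
    ∃ C : ℝ, 0 < C ∧
      ∀ (f : ℂ → ℂ) (D₁ : ℝ),
        AnalyticOnNhd ℂ f (Metric.ball (0 : ℂ) 1) →
        ‖f 0‖ = 1 →
        (∀ z ∈ Metric.ball (0 : ℂ) 1,
          ‖f z‖ ≤ Real.exp (D₁ / ((1 - ‖z‖) ^ p * Metric.infDist z E ^ q))) →
        Summable (fun z : diskZeros f =>
            blaschkeTerm f E (p + 1 + ε) (max (q - 1 + ε) 0) z) ∧
          ∑' z : diskZeros f, blaschkeTerm f E (p + 1 + ε) (max (q - 1 + ε) 0) z ≤ C * D₁ := by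
  lift E to Finset ℂ using hEfin
  have hne : E.Nonempty := by simpa using hEne
  have hE1 : ∀ ζ ∈ E, ‖ζ‖ = 1 := fun ζ hζ => mem_sphere_zero_iff_norm.1 (hE hζ)
  set a := max (q - 1 + ε) 0
  have ha : 0 ≤ a := le_max_right _ _
  have hb : 0 ≤ a / 2 := by positivity
  have hV0 : ∀ z ∈ Metric.ball (0 : ℂ) 1, 0 ≤ ((1 - ‖z‖) ^ p * Metric.infDist z E ^ q)⁻¹ :=
    fun z hz => by
      have h1 : 0 < 1 - ‖z‖ := by linarith [mem_ball_zero_iff.1 hz]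
      have h2 := infDist_pos_of_mem_ball hne hE1 hz
      positivity
  obtain ⟨c₁, c₂, hc₁, -, hw⟩ := exists_circleWeight_bounds hne hE1 hb
  rw [mul_div_cancel₀ a two_ne_zero] at hw
  obtain ⟨C, hC, hbound⟩ := exists_weighted_blaschke_bound (s := p + 1 + ε) (by linarith)
    (by positivity) (analyticOnNhd_circleWeight (b := a / 2) hE1)
    (fun z hz => deriv_circleWeight hE1 hz)
    (fun z hz => re_mul_circleWeightLogDeriv_le hb hE1 hz)
    (fun z hz => norm_circleWeightLogDeriv_mul_le hb hE1 hz)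
    (continuousOn_majorant hne hE1) hV0
    (integrableOn_majorant_mul_weight hne hE1 hε ha (le_max_left _ _))
  -- `C` may be `0`; adding `1` only secures a positive constant.
  refine ⟨c₁⁻¹ * C + 1, by positivity, fun f D hf h0 hfD => ?_⟩
  -- The growth bound at `0`, where `‖f 0‖ = 1`, forces the exponent to be nonnegative.
  have hD : 0 ≤ D := by
    have h1 := hfD 0 (Metric.mem_ball_self one_pos)
    rw [h0, Real.one_le_exp_iff] at h1
    have h2 : 0 < Metric.infDist (0 : ℂ) E ^ q :=
      Real.rpow_pos_of_pos (infDist_pos_of_mem_ball hne hE1 (Metric.mem_ball_self one_pos)) q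
    rw [norm_zero, sub_zero, Real.one_rpow, one_mul] at h1
    simpa using (le_div_iff₀ h2).1 h1
  have hlog : ∀ z ∈ Metric.ball (0 : ℂ) 1,
      Real.log ‖f z‖ ≤ D * ((1 - ‖z‖) ^ p * Metric.infDist z E ^ q)⁻¹ := fun z hz => by
    rw [← div_eq_mul_inv]
    -- At a zero `Real.log 0 = 0`, so the bound there needs `0 ≤ D`.
    rcases eq_or_ne (f z) 0 with h | h
    · rw [h, norm_zero, Real.log_zero, div_eq_mul_inv]
      exact mul_nonneg hD (hV0 z hz)
    · exact (Real.log_le_iff_le_exp (norm_pos_iff.2 h)).2 (hfD z hz)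
  have hterm : ∀ z ∈ Metric.ball (0 : ℂ) 1, 0 ≤ blaschkeTerm f E (p + 1 + ε) a z ∧
      blaschkeTerm f E (p + 1 + ε) a z ≤ c₁⁻¹ * (analyticOrderNatAt f z *
        ((1 - ‖z‖ ^ 2) ^ (p + 1 + ε) * ‖circleWeight E (a / 2) z‖ ^ 2)) := fun z hz => by
    have h1 : 0 < 1 - ‖z‖ := by linarith [mem_ball_zero_iff.1 hz]
    have h2 := infDist_pos_of_mem_ball hne hE1 hz
    have h3 : 1 - ‖z‖ ≤ 1 - ‖z‖ ^ 2 := by nlinarith [norm_nonneg z]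
    have h4 : 0 ≤ p + 1 + ε := by linarith
    have h6 := one_sub_norm_sq_pos hz
    have h5 : Metric.infDist z E ^ a ≤ c₁⁻¹ * ‖circleWeight E (a / 2) z‖ ^ 2 := by
      rw [inv_mul_eq_div, le_div_iff₀ hc₁, mul_comm]
      exact (hw z hz).1
    unfold blaschkeTerm
    refine ⟨by positivity, ?_⟩
    calc _ ≤ (analyticOrderNatAt f z : ℝ) * ((1 - ‖z‖ ^ 2) ^ (p + 1 + ε) *
          (c₁⁻¹ * ‖circleWeight E (a / 2) z‖ ^ 2)) := by gcongr
      _ = _ := by ring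
  have hnonneg : ∀ z : diskZeros f, 0 ≤ blaschkeTerm f E (p + 1 + ε) a z :=
    fun z => (hterm z z.2.1).1
  have hsum : ∀ F : Finset (diskZeros f), ∑ z ∈ F, blaschkeTerm f E (p + 1 + ε) a z ≤
      (c₁⁻¹ * C + 1) * D := fun F => by
    have h1 := hbound f D hf h0 hD hlog (F.map (Function.Embedding.subtype _)) fun c hc => by
      obtain ⟨x, -, rfl⟩ := Finset.mem_map.1 hc
      exact x.2
    rw [Finset.sum_map] at h1
    calc _ ≤ ∑ z ∈ F, c₁⁻¹ * (analyticOrderNatAt f (z : ℂ) *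
          ((1 - ‖(z : ℂ)‖ ^ 2) ^ (p + 1 + ε) * ‖circleWeight E (a / 2) z‖ ^ 2)) :=
          Finset.sum_le_sum fun z _ => (hterm z z.2.1).2
      _ ≤ c₁⁻¹ * (C * D) := by
          rw [← Finset.mul_sum]
          exact mul_le_mul_of_nonneg_left h1 (by positivity)
      _ ≤ _ := by nlinarith
  have hs := summable_of_sum_le hnonneg hsum
  exact ⟨hs, hs.tsum_le_of_sum_le hsum⟩
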